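/- **Setting.** Let $N\ge 1$, $m, n_i, m_i\ge 0$, $t_0\in\mathbb R$, $\mathcal N=\{1,\dots,N\}$, $\mathcal M=\{1,\dots,m\}$; $\|\cdot\|_\infty$ is the maximum norm (and the induced matrix norm), and $\|x\|_A:=\inf_{a\in A}\|x-a\|_\infty$. Consider the agents $$\dot y_i=F_i(t,y_i,z_i)+\Gamma_i(t,w_i)u_i,\quad \dot z_i=Z_i(t,z_i,y_i),\quad w_i=W_i(y_i,z_i),\qquad i\in\mathcal N,$$ with $y_i,u_i\in\mathbb R^m$, $z_i\in\mathbb R^{n_i}$, $w_i\in\mathbb R^{m_i}$, and the edge-wise funnel coupling $$u_i=\Gamma_i(t,w_i)^{-1}\sum_{j\in\mathcal N_i}\mathrm{col}\Big(\mu_{ij}^1\big(\tfrac{\nu_{ij}^1}{\psi_{ij}^1(t)}\big),\dots,\mu_{ij}^m\big(\tfrac{\nu_{ij}^m}{\psi_{ij}^m(t)}\big)\Big),\qquad \nu_{ij}=y_j-y_i,$$ where $\mathcal N_i$ is the set of neighbours of $i$ in a graph $\mathcal G=(\mathcal N,\mathcal E)$. The coupling is defined only where $|\nu_{ij}^p|<\psi_{ij}^p(t)$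 for all edges and all $p\in\mathcal M$ (inside the funnel). Solutions are Carathéodory solutions, and solutions of the closed loop are maximal solutions inside the funnel. In particular their initial values lie inside the funnel. **Assumptions.** 1. $F_i,Z_i,\Gamma_i$ (defined for $t\ge t_0$) are measurable in $t$, locally Lipschitz in the remaining variables (locally uniformly in $t$), and bounded on compact sets of these variables uniformly in $t\ge t_0$; $W_i$ is locally Lipschitz. 2. $\Gamma_i(t,w)$ is always invertible, and $\|\Gamma_i(t,w)^{-1}\|_\infty\le M_\Gamma$ for some constant $M_\Gamma>0$. 3. $\mathcal G$ is undirected (without self-loops) and connected. 4. For all edges and $p\in\mathcal M$: $\psi_{ij}^p=\psi_{ji}^p:[t_0,\infty)\to(0,\infty)$ is bounded and $C^1$ with bounded derivative; $\mu_{ij}^p:(-1,1)\to\mathbb R$ is continuous, $\mu_{ij}^p(s)\to\pm\infty$ as $s\to\pm1$, and $\mu_{ij}^p(-s)=-\mu_{ji}^p(s)$. 5. Let $d_{\mathcal G}$ be the diameter of $\mathcal G$ and $\Psi(t):=\max_{p\in\mathcal M}\max_{(j,i)\in\mathcal E}\psi_{ij}^p(t)$ (with $\Psi:=0$ if there is no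 edge or $m=0$). For every initial time $t_1\ge t_0$, every initial value, and all locally absolutely continuous $e_i:[t_1,\infty)\to\mathbb R^m$ with $\|e_i(t)\|_\infty\le d_{\mathcal G}\Psi(t)$, the perturbed blended dynamics $$\dot s=\frac1N\sum_{i=1}^N F_i(t,s+e_i,z_i),\qquad \dot z_i=Z_i(t,z_i,s+e_i),\quad i\in\mathcal N,$$ has a global solution. **ISS.** Let $A$ be a nonempty closed set, $\beta\in\mathcal{KL}$ and $\hat\gamma\in\mathcal K_\infty$. Assume that the perturbed blended dynamics, with state $x=\mathrm{col}(s,z_1,\dots,z_N)$ and input $e=\mathrm{col}(e_1,\dots,e_N)$, is ISS with $(\beta,\hat\gamma)$ for $A$: for every initial time $t_1\ge t_0$, every initial value and every measurable, locally essentially bounded input $e$ on $[t_1,\infty)$, a global solution exists, and it satisfies $$\|x(t)\|_A\le\beta(\|x(t_1)\|_A,t-t_1)+\hat\gamma\big(\operatorname{ess\,sup}_{s\in[t_1,t)}\|e(s)\|_\infty\big)\qquad\text{for all }t\ge t_1.$$ **Theorem.** Under these assumptions, for every $M_{x_0}>0$ and every non-increasing $w:[0,\infty)\to(0,1]$ with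 $\lim_{t\to\infty}w(t)=0$ there exists $\gamma\in\mathcal K_\infty$ such that the following holds for every initial time $t_1\ge t_0$. Every maximal solution $\mathrm{col}(y_1,z_1,\dots,y_N,z_N)$ of the closed loop starting at time $t_1$ inside the funnel with $\big\|\mathrm{col}\big(\tfrac1N\sum_{i}y_i(t_1),z_1(t_1),\dots,z_N(t_1)\big)\big\|_A\le M_{x_0}$ exists on $[t_1,\infty)$, and for all $t\ge t_1$ $$\max_{i\in\mathcal N}\left\|\begin{bmatrix}y_i(t)\\z_1(t)\\\vdots\\z_N(t)\end{bmatrix}\right\|_A\le\beta\left(\left\|\begin{bmatrix}\frac1N\sum_{i=1}^N y_i(t_1)\\z_1(t_1)\\\vdots\\z_N(t_1)\end{bmatrix}\right\|_A,\,t-t_1\right)+\gamma\Big(\sup_{s\in[t_1,t)}d_{\mathcal G}\Psi(s)\,w(t-s)\Big)+d_{\mathcal G}\Psi(t),$$ where the supremum over the empty set is $0$. -/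

import Mathlib

open MeasureTheory Filter Topology
open scoped Matrix ENNReal

namespace FunnelCoupling

/-! ### Comparison functions -/

/-- Class `K` functions on `[0, ∞)` (values at negative arguments are irrelevant). -/
structure IsClassK (α : ℝ → ℝ) : Prop where
  continuousOn : ContinuousOn α (Set.Ici 0)
  strictMonoOn : StrictMonoOn α (Set.Ici 0)
  map_zero : α 0 = 0

/-- Class `K∞` functions on `[0, ∞)`. -/
structure IsClassKInfty (α : ℝ → ℝ) : Prop extends IsClassK α where
  tendsto_atTop : Tendsto α atTop atTop

/-- Class `KL` functions on `[0, ∞) × [0, ∞)`. -/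
structure IsClassKL (β : ℝ → ℝ → ℝ) : Prop where
  isClassK : ∀ t, 0 ≤ t → IsClassK (fun r => β r t)
  antitoneOn : ∀ r, 0 ≤ r → AntitoneOn (β r) (Set.Ici 0)
  tendsto_zero : ∀ r, 0 ≤ r → Tendsto (β r) atTop (𝓝 0)

/-! ### Carathéodory solutions -/

/-- The time interval `[t₁, ω)` with `ω ≤ ∞`. -/
def timeInterval (t₁ : ℝ) (ω : EReal) : Set ℝ := {t | t₁ ≤ t ∧ (t : EReal) < ω}

section Systems

variable {X U : Type*} [NormedAddCommGroup X] [NormedSpace ℝ X] [NormedAddCommGroup U]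

/-- `x` is a Carathéodory solution on `[t₁, ω)` of `x' = f (t, x)`, where the right-hand side is
only considered on the domain `Ω`: `x` is the integral of the locally integrable function
`s ↦ f (s, x s)`, i.e. `x` is locally absolutely continuous and solves the equation almost
everywhere, and its graph lies in `Ω`. -/
structure IsSolution (Ω : Set (ℝ × X)) (f : ℝ → X → X) (t₁ : ℝ) (ω : EReal) (x : ℝ → X) :
    Prop where
  lt : (t₁ : EReal) < ω
  mem_domain : ∀ t ∈ timeInterval t₁ ω, (t, x t) ∈ Ω
  integrable : ∀ t ∈ timeInterval t₁ ω, IntervalIntegrable (fun s => f s (x s)) volume t₁ t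
  eq_integral : ∀ t ∈ timeInterval t₁ ω, x t = x t₁ + ∫ s in t₁..t, f s (x s)

/-- A solution on `[t₁, ω)` that has no extension to a solution on a longer interval. -/
structure IsMaximalSolution (Ω : Set (ℝ × X)) (f : ℝ → X → X) (t₁ : ℝ) (ω : EReal)
    (x : ℝ → X) : Prop where
  isSolution : IsSolution Ω f t₁ ω x
  maximal : ∀ (ω₂ : EReal) (x₂ : ℝ → X), IsSolution Ω f t₁ ω₂ x₂ →
    Set.EqOn x₂ x (timeInterval t₁ ω) → ω₂ ≤ ω

/-- Measurable and locally essentially bounded inputs on `[t₁, ∞)`. -/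
def IsLocEssBounded (t₁ : ℝ) (u : ℝ → U) : Prop :=
  ∀ T, MemLp u ∞ (volume.restrict (Set.Icc t₁ T))

/-- The system `x' = f (t, x, u)` on the time axis `[t₀, ∞)` is ISS with `(β, γ)` for the set `A`:
for every initial time `t₁ ≥ t₀`, initial value and locally essentially bounded input there is a
global solution, and global solutions satisfy the ISS estimate. -/
structure IsISS (t₀ : ℝ) (f : ℝ → X → U → X) (β : ℝ → ℝ → ℝ) (γ : ℝ → ℝ) (A : Set X) :
    Prop where
  isClassKL : IsClassKL β
  isClassKInfty : IsClassKInfty γ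
  exists_global : ∀ t₁, t₀ ≤ t₁ → ∀ (x₁ : X) (u : ℝ → U), IsLocEssBounded t₁ u →
    ∃ x : ℝ → X, x t₁ = x₁ ∧ IsSolution Set.univ (fun t ξ => f t ξ (u t)) t₁ ⊤ x
  estimate : ∀ t₁, t₀ ≤ t₁ → ∀ (u : ℝ → U) (x : ℝ → X), IsLocEssBounded t₁ u →
    IsSolution Set.univ (fun t ξ => f t ξ (u t)) t₁ ⊤ x →
    ∀ t, t₁ ≤ t → Metric.infDist (x t) A ≤
      β (Metric.infDist (x t₁) A) (t - t₁) +
        γ (eLpNorm u ∞ (volume.restrict (Set.Ico t₁ t))).toReal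

end Systems

/-! ### Regularity of the vector fields -/

/-- `f : [t₀, ∞) × E → E₂` is measurable in `t`, locally Lipschitz in `x` (locally uniformly in
`t`), and bounded on compact sets of `x`, uniformly in `t`. -/
structure IsRegularField {E E₂ : Type*} [PseudoMetricSpace E] [NormedAddCommGroup E₂]
    (t₀ : ℝ) (f : ℝ → E → E₂) : Prop where
  measurable : ∀ x, AEStronglyMeasurable (fun t => f t x) (volume.restrict (Set.Ici t₀))
  lipschitz : ∀ K : Set E, IsCompact K → ∀ T : ℝ, ∃ L : NNReal, ∀ t ∈ Set.Icc t₀ T,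
    LipschitzOnWith L (f t) K
  bounded : ∀ K : Set E, IsCompact K → ∃ M : ℝ, ∀ t, t₀ ≤ t → ∀ x ∈ K, ‖f t x‖ ≤ M

/-! ### The multi-agent system -/

/-- The data of a heterogeneous multi-agent system with `N` agents, output dimension `m`, internal
dimensions `n i` and introspective output dimensions `q i`, together with a communication graph,
coupling functions `μ i j p` and performance functions `ψ i j p`.  All vector spaces `Fin k → ℝ`
carry the maximum norm. -/
structure MultiAgentSystem (N m : ℕ) (n q : Fin N → ℕ) where
  F : (i : Fin N) → ℝ → (Fin m → ℝ) → (Fin (n i) → ℝ) → (Fin m → ℝ)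
  Z : (i : Fin N) → ℝ → (Fin (n i) → ℝ) → (Fin m → ℝ) → (Fin (n i) → ℝ)
  Γ : (i : Fin N) → ℝ → (Fin (q i) → ℝ) → Matrix (Fin m) (Fin m) ℝ
  W : (i : Fin N) → (Fin m → ℝ) → (Fin (n i) → ℝ) → (Fin (q i) → ℝ)
  G : SimpleGraph (Fin N)
  μ : Fin N → Fin N → Fin m → ℝ → ℝ
  ψ : Fin N → Fin N → Fin m → ℝ → ℝ

/-- The tuple `(z₁, …, z_N)` of internal states. -/
abbrev Internal {N : ℕ} (n : Fin N → ℕ) : Type := (i : Fin N) → Fin (n i) → ℝ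

/-- The state `((y₁, …, y_N), (z₁, …, z_N))` of the closed loop. -/
abbrev NetworkState {N : ℕ} (m : ℕ) (n : Fin N → ℕ) : Type :=
  (Fin N → Fin m → ℝ) × Internal n

/-- The state `col (s, z₁, …, z_N)` of the (perturbed) blended dynamics; its norm is the
maximum norm. -/
abbrev BlendedState {N : ℕ} (m : ℕ) (n : Fin N → ℕ) : Type := (Fin m → ℝ) × Internal n

namespace MultiAgentSystem

variable {N m : ℕ} {n q : Fin N → ℕ} (S : MultiAgentSystem N m n q)

/-- The edge coupling `u_ij (t, ν)`. -/
noncomputable def edgeCoupling (i j : Fin N) (t : ℝ) (ν : Fin m → ℝ) : Fin m → ℝ :=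
  fun p => S.μ i j p (ν p / S.ψ i j p t)

open Classical in
/-- The edge-wise funnel coupling law `u_i`. -/
noncomputable def coupling (i : Fin N) (t : ℝ) (x : NetworkState m n) : Fin m → ℝ :=
  (S.Γ i t (S.W i (x.1 i) (x.2 i)))⁻¹ *ᵥ
    ∑ j : Fin N with S.G.Adj i j, S.edgeCoupling i j t (x.1 j - x.1 i)

/-- The right-hand side of the multi-agent system with the edge-wise funnel coupling law. -/
noncomputable def closedLoop (t : ℝ) (x : NetworkState m n) : NetworkState m n :=
  (fun i => S.F i t (x.1 i) (x.2 i) +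
      S.Γ i t (S.W i (x.1 i) (x.2 i)) *ᵥ S.coupling i t x,
   fun i => S.Z i t (x.2 i) (x.1 i))

/-- The funnel: the set where the coupling law is defined, since the coupling functions
are functions on `(-1, 1)`. -/
def funnel : Set (ℝ × NetworkState m n) :=
  {a | ∀ i j p, S.G.Adj i j → |a.2.1 j p - a.2.1 i p| < S.ψ i j p a.1}

/-- The right-hand side of the perturbed blended dynamics with input `e = (e₁, …, e_N)`. -/
noncomputable def blended (t : ℝ) (x : BlendedState m n) (e : Fin N → Fin m → ℝ) :
    BlendedState m n :=
  ((1 / (N : ℝ)) • ∑ i, S.F i t (x.1 + e i) (x.2 i),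
   fun i => S.Z i t (x.2 i) (x.1 + e i))

/-- `Ψ t`, the maximum of the performance functions over all edges and all components. -/
noncomputable def Psi (t : ℝ) : ℝ :=
  ⨆ a : {a : Fin N × Fin N × Fin m // S.G.Adj a.1 a.2.1}, S.ψ a.1.1 a.1.2.1 a.1.2.2 t

/-- `d_G Ψ(t)`, with `d_G` the diameter of the communication graph. -/
noncomputable def syncBound (t : ℝ) : ℝ := (S.G.diam : ℝ) * S.Psi t

section

attribute [local instance] Matrix.linftyOpNormedAddCommGroup

/-- Assumption on the open loop dynamics. -/
structure OpenLoopAssumption (t₀ : ℝ) : Prop where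
  F_regular : ∀ i, IsRegularField t₀
    (fun t (x : (Fin m → ℝ) × (Fin (n i) → ℝ)) => S.F i t x.1 x.2)
  Z_regular : ∀ i, IsRegularField t₀
    (fun t (x : (Fin m → ℝ) × (Fin (n i) → ℝ)) => S.Z i t x.2 x.1)
  Γ_regular : ∀ i, IsRegularField t₀ (S.Γ i)
  W_lipschitz : ∀ i, LocallyLipschitz
    (fun x : (Fin m → ℝ) × (Fin (n i) → ℝ) => S.W i x.1 x.2)

/-- Assumption on the gain matrices; the norm is the matrix norm induced by the maximum norm. -/
structure GainAssumption (t₀ : ℝ) : Prop where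
  invertible : ∀ i t w, t₀ ≤ t → IsUnit (S.Γ i t w)
  inv_bounded : ∃ M : ℝ, 0 < M ∧ ∀ i t w, t₀ ≤ t → ‖(S.Γ i t w)⁻¹‖ ≤ M

end

/-- Assumption on the design functions. -/
structure DesignAssumption (t₀ : ℝ) : Prop where
  ψ_pos : ∀ i j p, S.G.Adj i j → ∀ t, t₀ ≤ t → 0 < S.ψ i j p t
  ψ_bounded : ∀ i j p, S.G.Adj i j → ∃ M : ℝ, ∀ t, t₀ ≤ t → S.ψ i j p t ≤ M
  ψ_contDiffOn : ∀ i j p, S.G.Adj i j → ContDiffOn ℝ 1 (S.ψ i j p) (Set.Ici t₀)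
  ψ_deriv_bounded : ∀ i j p, S.G.Adj i j →
    ∃ M : ℝ, ∀ t, t₀ ≤ t → |derivWithin (S.ψ i j p) (Set.Ici t₀) t| ≤ M
  ψ_symm : ∀ i j p, S.G.Adj i j → ∀ t, t₀ ≤ t → S.ψ i j p t = S.ψ j i p t
  μ_continuousOn : ∀ i j p, S.G.Adj i j → ContinuousOn (S.μ i j p) (Set.Ioo (-1) 1)
  μ_tendsto_right : ∀ i j p, S.G.Adj i j → Tendsto (S.μ i j p) (𝓝[<] 1) atTop
  μ_tendsto_left : ∀ i j p, S.G.Adj i j → Tendsto (S.μ i j p) (𝓝[>] (-1)) atBot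
  μ_symm : ∀ i j p, S.G.Adj i j → ∀ r ∈ Set.Ioo (-1 : ℝ) 1, S.μ i j p (-r) = -S.μ j i p r

/-- Assumption that the perturbed blended dynamics has no finite escape time. -/
def NoFiniteEscape (t₀ : ℝ) : Prop :=
  ∀ t₁, t₀ ≤ t₁ → ∀ e : ℝ → Fin N → Fin m → ℝ,
    (∀ T, t₁ ≤ T → AbsolutelyContinuousOnInterval e t₁ T) →
    (∀ t, t₁ ≤ t → ∀ i, ‖e t i‖ ≤ S.syncBound t) →
    ∀ x₁ : BlendedState m n, ∃ x : ℝ → BlendedState m n,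
      x t₁ = x₁ ∧ IsSolution Set.univ (fun t ξ => S.blended t ξ (e t)) t₁ ⊤ x

end MultiAgentSystem

end FunnelCoupling

/-!
By antisymmetry the coupling forces of all agents sum to zero, so the average output of a closed
loop solution solves the blended dynamics whose input is the deviation of the outputs from their
average. Inside the funnel this deviation is at most `d_G Ψ`. The estimate for the average is the
ISS estimate restarted at time `t - T`: what happened before is forgotten at rate `β (·) T`, and the
inputs since then are at most `(⨆ s, d_G Ψ(s) w(t - s)) / w T`; the gain comes from the infimum over
`T`.

It remains to see that a maximal solution is global. If it ended at a finite time `b`, then it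
would be bounded by comparison with a blended solution. The coupling dissipates the energy
`∑ ‖y_i‖²`, and near the boundary of the funnel its power dominates its size; hence the closed loop
field is integrable along the solution, which converges to a limit at `b`. At the limit no edge is
saturated: an agent with the largest output among those of saturated edges is pulled down by a
force which tends to `-∞` and would have to leave the funnel backwards in time. So the limit lies
in the funnel, and the local solution through it (Carathéodory) extends the maximal one.
-/

namespace FunnelCoupling

/-! ### Integrals of vector-valued functions of a real variable -/

section Integral

theorem intervalIntegrable_of_norm_le {E : Type*} [NormedAddCommGroup E] {g : ℝ → E} {B : ℝ}
    (hg : AEStronglyMeasurable g volume) (hB : ∀ t, ‖g t‖ ≤ B) (c d : ℝ) :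
    IntervalIntegrable g volume c d :=
  (intervalIntegrable_const (c := B)).mono_fun hg.restrict
    (ae_of_all _ fun t => (hB t).trans (Real.le_norm_self B))

theorem lipschitzWith_integral {E : Type*} [NormedAddCommGroup E] [NormedSpace ℝ E] {g : ℝ → E}
    {B : NNReal} (hg : AEStronglyMeasurable g volume) (hB : ∀ t, ‖g t‖ ≤ B) (a : ℝ) :
    LipschitzWith B fun t => ∫ s in a..t, g s := by
  have hint := intervalIntegrable_of_norm_le hg hB
  refine LipschitzWith.of_dist_le_mul fun d c => ?_
  rw [dist_eq_norm, intervalIntegral.integral_interval_sub_left (hint a d) (hint a c)]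
  exact intervalIntegral.norm_integral_le_of_norm_le_const fun t _ => hB t

theorem eq_zero_of_le_mul_integral {v : ℝ → ℝ} {a b : ℝ} {L : NNReal}
    (hv : ContinuousOn v (Set.Icc a b)) (h0 : ∀ t ∈ Set.Icc a b, 0 ≤ v t)
    (hle : ∀ t ∈ Set.Icc a b, v t ≤ L * ∫ s in a..t, v s) :
    ∀ t ∈ Set.Icc a b, v t = 0 := by
  intro t ht
  have hab : a ≤ b := ht.1.trans ht.2
  let u : ℝ → ℝ := Set.IccExtend hab fun t : Set.Icc a b => v t
  have hu : Continuous u := continuousOn_iff_continuous_domRestrict.1 hv |>.Icc_extend'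
  have huv : ∀ t ∈ Set.Icc a b, u t = v t := fun t ht => Set.IccExtend_of_mem hab _ ht
  have hU : ∀ t, HasDerivAt (fun t => ∫ s in a..t, u s) (u t) t := fun t =>
    hu.integral_hasStrictDerivAt a t |>.hasDerivAt
  have hUv : ∀ t ∈ Set.Icc a b, ∫ s in a..t, u s = ∫ s in a..t, v s := fun t ht =>
    intervalIntegral.integral_congr fun s hs => by
      rw [Set.uIcc_of_le ht.1] at hs
      exact huv s ⟨hs.1, hs.2.trans ht.2⟩
  have hgronwall : ∫ s in a..t, u s ≤ gronwallBound 0 L 0 (t - a) :=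
    le_gronwallBound_of_liminf_deriv_right_le (f' := u)
      (fun t _ => (hU t).continuousAt.continuousWithinAt)
      (fun t _ r hr => (hU t).hasDerivWithinAt.liminf_right_slope_le hr) (by simp)
      (fun t ht => by
        have ht' := Set.Ico_subset_Icc_self ht
        rw [hUv t ht', huv t ht', add_zero]
        exact hle t ht') t ht
  rw [gronwallBound_ε0_δ0, hUv t ht] at hgronwall
  exact ((hle t ht).trans (mul_nonpos_of_nonneg_of_nonpos L.2 hgronwall)).antisymm (h0 t ht)

theorem integral_primitive_mul {y g : ℝ → ℝ} {a b : ℝ} (hab : a ≤ b)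
    (hg : IntervalIntegrable g volume a b)
    (hy : ∀ t ∈ Set.Icc a b, y t = y a + ∫ s in a..t, g s) :
    ∫ t in a..b, y t * g t = (y b ^ 2 - y a ^ 2) / 2 := by
  let Y : ℝ → ℝ := fun t => y a + ∫ s in a..t, g s
  have hYac : AbsolutelyContinuousOnInterval Y a b :=
    ((LipschitzWith.const (y a)).lipschitzOnWith.absolutelyContinuousOnInterval).add
      (hg.absolutelyContinuousOnInterval_intervalIntegral Set.left_mem_uIcc)
  have hcongr : ∫ t in a..b, deriv Y t * Y t + Y t * deriv Y t = ∫ t in a..b, 2 * (y t * g t) := by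
    refine intervalIntegral.integral_congr_ae ?_
    filter_upwards [hg.ae_hasDerivAt_integral] with t ht hmem
    have hm := Set.uIoc_subset_uIcc hmem
    rw [((ht hm a Set.left_mem_uIcc).const_add _).deriv]
    rw [Set.uIcc_of_le hab] at hm
    rw [hy t hm]
    ring
  have key := hYac.integral_deriv_mul_eq_sub hYac
  rw [hcongr, intervalIntegral.integral_const_mul,
    show Y a = y a by simp [Y], show Y b = y b from (hy b ⟨hab, le_rfl⟩).symm] at key
  linarith

theorem sub_le_of_eventually_ge {y g : ℝ → ℝ} {a b l C : ℝ} (hab : a < b)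
    (hg : IntervalIntegrable g volume a b)
    (hy : ∀ t ∈ Set.Ico a b, y t = l - ∫ s in t..b, g s)
    (h : ∀ᶠ t in 𝓝[<] b, -C ≤ g t) : ∀ᶠ t in 𝓝[<] b, y t - l ≤ C * (b - t) := by
  obtain ⟨u, hu, hC⟩ := (mem_nhdsLT_iff_exists_Ioo_subset).1 h
  filter_upwards [Ioo_mem_nhdsLT (max_lt hu hab)] with t ht
  have hat : a ≤ t := (le_max_right _ _).trans ht.1.le
  have hti : IntervalIntegrable g volume t b := hg.mono_set (by
    rw [Set.uIcc_of_le ht.2.le, Set.uIcc_of_le hab.le]; exact Set.Icc_subset_Icc_left hat)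
  have hle : (∫ _ in t..b, -C) ≤ ∫ s in t..b, g s :=
    intervalIntegral.integral_mono_on_of_le_Ioo ht.2.le intervalIntegrable_const hti
      fun s hs => hC ⟨((le_max_left _ _).trans_lt ht.1).trans hs.1, hs.2⟩
  rw [intervalIntegral.integral_const, smul_eq_mul] at hle
  rw [hy t ⟨hat, ht.2⟩]
  linarith

end Integral

/-! ### Carathéodory solutions -/

section Solution

variable {X : Type*} [NormedAddCommGroup X] [NormedSpace ℝ X] {Ω Ω' : Set (ℝ × X)}
  {f g : ℝ → X → X} {t₁ : ℝ} {ω : EReal} {x y : ℝ → X}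

theorem mem_timeInterval_of_le {s t : ℝ} (ht : t ∈ timeInterval t₁ ω) (h₁ : t₁ ≤ s) (h₂ : s ≤ t) :
    s ∈ timeInterval t₁ ω :=
  ⟨h₁, (EReal.coe_le_coe_iff.2 h₂).trans_lt ht.2⟩

theorem timeInterval_coe (b : ℝ) : timeInterval t₁ b = Set.Ico t₁ b := by
  ext; simp [timeInterval]

theorem timeInterval_top : timeInterval t₁ ⊤ = Set.Ici t₁ := by
  ext; simp [timeInterval, EReal.coe_lt_top]

theorem measurableSet_timeInterval : MeasurableSet (timeInterval t₁ ω) :=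
  measurableSet_Ici.inter (measurable_coe_real_ereal measurableSet_Iio)

namespace IsSolution

theorem integrable_of_le (hx : IsSolution Ω f t₁ ω x) {s t : ℝ} (h₁ : t₁ ≤ s) (hst : s ≤ t)
    (ht : t ∈ timeInterval t₁ ω) : IntervalIntegrable (fun r => f r (x r)) volume s t :=
  (hx.integrable s (mem_timeInterval_of_le ht h₁ hst)).symm.trans (hx.integrable t ht)

theorem eq_add_integral (hx : IsSolution Ω f t₁ ω x) {s t : ℝ} (h₁ : t₁ ≤ s) (hst : s ≤ t)
    (ht : t ∈ timeInterval t₁ ω) : x t = x s + ∫ r in s..t, f r (x r) := by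
  have hs := mem_timeInterval_of_le ht h₁ hst
  rw [hx.eq_integral t ht, hx.eq_integral s hs, add_assoc,
    intervalIntegral.integral_add_adjacent_intervals (hx.integrable s hs)
      (hx.integrable_of_le h₁ hst ht)]

theorem continuousOn_Icc (hx : IsSolution Ω f t₁ ω x) {T : ℝ} (hT : T ∈ timeInterval t₁ ω) :
    ContinuousOn x (Set.Icc t₁ T) := by
  have h := intervalIntegral.continuousOn_primitive_interval' (hx.integrable T hT) Set.left_mem_uIcc
  rw [Set.uIcc_of_le hT.1] at h
  exact (continuousOn_const.add h).congr fun t ht =>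
    hx.eq_integral t (mem_timeInterval_of_le hT ht.1 ht.2)

theorem continuousOn (hx : IsSolution Ω f t₁ ω x) : ContinuousOn x (timeInterval t₁ ω) := by
  intro t ht
  obtain ⟨u, htu, huω⟩ := EReal.lt_iff_exists_real_btwn.1 ht.2
  have htu' : t < u := EReal.coe_lt_coe_iff.1 htu
  refine (hx.continuousOn_Icc ⟨ht.1.trans htu'.le, huω⟩ t ⟨ht.1, htu'.le⟩).mono_of_mem_nhdsWithin ?_
  filter_upwards [self_mem_nhdsWithin, mem_nhdsWithin_of_mem_nhds (gt_mem_nhds htu')] with s hs hsu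
  exact ⟨hs.1, hsu.le⟩

theorem mono_right {ω' : EReal} (hx : IsSolution Ω f t₁ ω x) (h : (t₁ : EReal) < ω')
    (hle : ω' ≤ ω) : IsSolution Ω f t₁ ω' x where
  lt := h
  mem_domain t ht := hx.mem_domain t ⟨ht.1, ht.2.trans_le hle⟩
  integrable t ht := hx.integrable t ⟨ht.1, ht.2.trans_le hle⟩
  eq_integral t ht := hx.eq_integral t ⟨ht.1, ht.2.trans_le hle⟩

theorem restart (hx : IsSolution Ω f t₁ ω x) {t₂ : ℝ} (h : t₂ ∈ timeInterval t₁ ω) :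
    IsSolution Ω f t₂ ω x where
  lt := h.2
  mem_domain t ht := hx.mem_domain t ⟨h.1.trans ht.1, ht.2⟩
  integrable _ ht := hx.integrable_of_le h.1 ht.1 ⟨h.1.trans ht.1, ht.2⟩
  eq_integral _ ht := hx.eq_add_integral h.1 ht.1 ⟨h.1.trans ht.1, ht.2⟩

theorem congr (hx : IsSolution Ω f t₁ ω x) (hΩ' : ∀ t ∈ timeInterval t₁ ω, (t, x t) ∈ Ω')
    (hfg : ∀ t ∈ timeInterval t₁ ω, f t (x t) = g t (x t)) : IsSolution Ω' g t₁ ω x where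
  lt := hx.lt
  mem_domain := hΩ'
  integrable t ht := (hx.integrable t ht).congr fun s hs => by
    rw [Set.uIoc_of_le ht.1] at hs
    exact hfg s (mem_timeInterval_of_le ht hs.1.le hs.2)
  eq_integral t ht := by
    rw [hx.eq_integral t ht]
    refine congrArg _ (intervalIntegral.integral_congr fun s hs => ?_)
    rw [Set.uIcc_of_le ht.1] at hs
    exact hfg s (mem_timeInterval_of_le ht hs.1 hs.2)

theorem map [CompleteSpace X] {Y : Type*} [NormedAddCommGroup Y] [NormedSpace ℝ Y]
    [CompleteSpace Y] (hx : IsSolution Ω f t₁ ω x) (P : X →L[ℝ] Y) {k : ℝ → Y → Y}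
    (hk : ∀ t ∈ timeInterval t₁ ω, P (f t (x t)) = k t (P (x t))) :
    IsSolution Set.univ k t₁ ω fun t => P (x t) := by
  have hP : IsSolution Set.univ (fun t _ => P (f t (x t))) t₁ ω fun t => P (x t) :=
    { lt := hx.lt
      mem_domain := fun _ _ => Set.mem_univ _
      integrable := fun t ht =>
        ⟨P.integrable_comp (hx.integrable t ht).1, P.integrable_comp (hx.integrable t ht).2⟩
      eq_integral := fun t ht => by
        rw [hx.eq_integral t ht, map_add, ← P.intervalIntegral_comp_comm (hx.integrable t ht)] }
  exact hP.congr (fun _ _ => Set.mem_univ _) hk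

theorem eqOn_of_lipschitzOnWith (hx : IsSolution Ω f t₁ ω x) (hy : IsSolution Ω' f t₁ ω y)
    (h₁ : x t₁ = y t₁)
    (hf : ∀ K : Set X, IsCompact K → ∀ T : ℝ, ∃ L : NNReal, ∀ t ∈ Set.Icc t₁ T,
      LipschitzOnWith L (f t) K) :
    Set.EqOn x y (timeInterval t₁ ω) := by
  intro T hT
  have hxc := hx.continuousOn_Icc hT
  have hyc := hy.continuousOn_Icc hT
  obtain ⟨L, hL⟩ := hf _ ((isCompact_Icc.image_of_continuousOn hxc).union
    (isCompact_Icc.image_of_continuousOn hyc)) T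
  have hnorm : ContinuousOn (fun t => ‖x t - y t‖) (Set.Icc t₁ T) := (hxc.sub hyc).norm
  refine sub_eq_zero.1 (norm_eq_zero.1 (eq_zero_of_le_mul_integral (L := L) hnorm
    (fun t _ => norm_nonneg _) (fun t ht => ?_) T ⟨hT.1, le_rfl⟩))
  have ht' := mem_timeInterval_of_le hT ht.1 ht.2
  rw [hx.eq_integral t ht', hy.eq_integral t ht', h₁, add_sub_add_left_eq_sub,
    ← intervalIntegral.integral_sub (hx.integrable t ht') (hy.integrable t ht'),
    ← intervalIntegral.integral_const_mul]
  refine intervalIntegral.norm_integral_le_of_norm_le ht.1 (ae_of_all _ fun s hs => ?_) ?_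
  · have hs' : s ∈ Set.Icc t₁ T := ⟨hs.1.le, hs.2.trans ht.2⟩
    exact (hL s hs').norm_sub_le (Or.inl ⟨s, hs', rfl⟩) (Or.inr ⟨s, hs', rfl⟩)
  · refine ContinuousOn.intervalIntegrable_of_Icc ht.1 ?_
    exact continuousOn_const.mul (hnorm.mono (Set.Icc_subset_Icc_right ht.2))

section Endpoint

variable {b : ℝ}

theorem eq_sub_integral (hx : IsSolution Ω f t₁ b x)
    (hint : IntervalIntegrable (fun s => f s (x s)) volume t₁ b) {t : ℝ} (ht : t ∈ Set.Ico t₁ b) :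
    x t = (x t₁ + ∫ s in t₁..b, f s (x s)) - ∫ s in t..b, f s (x s) := by
  rw [← timeInterval_coe] at ht
  have htb : IntervalIntegrable (fun s => f s (x s)) volume t b :=
    (hx.integrable t ht).symm.trans hint
  rw [hx.eq_integral t ht, ← intervalIntegral.integral_add_adjacent_intervals
    (hx.integrable t ht) htb, ← add_assoc, add_sub_cancel_right]

theorem tendsto_nhdsLT (hx : IsSolution Ω f t₁ b x)
    (hint : IntervalIntegrable (fun s => f s (x s)) volume t₁ b) :
    Tendsto x (𝓝[<] b) (𝓝 (x t₁ + ∫ s in t₁..b, f s (x s))) := by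
  have hlt : t₁ < b := EReal.coe_lt_coe_iff.1 hx.lt
  have h := intervalIntegral.continuousOn_primitive_interval' hint Set.left_mem_uIcc
  rw [Set.uIcc_of_le hlt.le] at h
  refine Tendsto.congr' ?_ (((h b ⟨hlt.le, le_rfl⟩).mono_of_mem_nhdsWithin
    (mem_of_superset (Ioo_mem_nhdsLT hlt) Set.Ioo_subset_Icc_self)).tendsto.const_add (x t₁))
  filter_upwards [Ioo_mem_nhdsLT hlt] with t ht
  exact (hx.eq_integral t (timeInterval_coe b ▸ ⟨ht.1.le, ht.2⟩)).symm

theorem exists_concat (hx : IsSolution Ω f t₁ b x)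
    (hint : IntervalIntegrable (fun s => f s (x s)) volume t₁ b) (hy : IsSolution Ω f b ω y)
    (hyb : y b = x t₁ + ∫ s in t₁..b, f s (x s)) :
    ∃ z, IsSolution Ω f t₁ ω z ∧ Set.EqOn z x (timeInterval t₁ b) := by
  have hlt : t₁ < b := EReal.coe_lt_coe_iff.1 hx.lt
  let z : ℝ → X := fun t => if t < b then x t else y t
  have hzx : ∀ t < b, z t = x t := fun t ht => if_pos ht
  have hzy : ∀ t, b ≤ t → z t = y t := fun t ht => if_neg ht.not_gt
  have hz₁ : z t₁ = x t₁ := hzx t₁ hlt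
  have hfx : ∀ t ∈ Set.Icc t₁ b, (fun s => f s (x s)) =ᵐ[volume.restrict (Set.uIoc t₁ t)]
      fun s => f s (z s) := fun t ht => by
    filter_upwards [ae_restrict_mem measurableSet_uIoc, ae_restrict_of_ae (Measure.ae_ne volume b)]
      with s hs hsb
    rw [Set.uIoc_of_le ht.1] at hs
    rw [hzx s (lt_of_le_of_ne (hs.2.trans ht.2) hsb)]
  have hfy : ∀ t, b ≤ t → Set.EqOn (fun s => f s (y s)) (fun s => f s (z s)) (Set.uIcc b t) :=
    fun t ht s hs => by
      rw [Set.uIcc_of_le ht] at hs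
      simp only [hzy s hs.1]
  have hint_b : IntervalIntegrable (fun s => f s (z s)) volume t₁ b :=
    hint.congr_ae (hfx b ⟨hlt.le, le_rfl⟩)
  have hint_y : ∀ t, b ≤ t → t ∈ timeInterval t₁ ω →
      IntervalIntegrable (fun s => f s (z s)) volume b t := fun t hbt ht =>
    (hy.integrable t ⟨hbt, ht.2⟩).congr ((hfy t hbt).mono Set.uIoc_subset_uIcc)
  refine ⟨z, ⟨hx.lt.trans hy.lt, fun t ht => ?_, fun t ht => ?_, fun t ht => ?_⟩,
    fun t ht => hzx t (EReal.coe_lt_coe_iff.1 ht.2)⟩ <;> rcases lt_or_ge t b with htb | hbt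
  · rw [hzx t htb]
    exact hx.mem_domain t ⟨ht.1, EReal.coe_lt_coe_iff.2 htb⟩
  · rw [hzy t hbt]
    exact hy.mem_domain t ⟨hbt, ht.2⟩
  · exact (hx.integrable t ⟨ht.1, EReal.coe_lt_coe_iff.2 htb⟩).congr_ae (hfx t ⟨ht.1, htb.le⟩)
  · exact hint_b.trans (hint_y t hbt ht)
  · rw [hz₁, hzx t htb, ← intervalIntegral.integral_congr_ae_restrict (hfx t ⟨ht.1, htb.le⟩)]
    exact hx.eq_integral t ⟨ht.1, EReal.coe_lt_coe_iff.2 htb⟩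
  · rw [hz₁, hzy t hbt, hy.eq_integral t ⟨hbt, ht.2⟩, hyb, add_assoc,
      ← intervalIntegral.integral_add_adjacent_intervals hint_b (hint_y t hbt ht),
      intervalIntegral.integral_congr_ae_restrict (hfx b ⟨hlt.le, le_rfl⟩),
      intervalIntegral.integral_congr (hfy t hbt)]

end Endpoint

end IsSolution

end Solution

/-! ### Carathéodory–Peano existence theorem -/

section Peano

variable {X : Type*} [NormedAddCommGroup X] [NormedSpace ℝ X] {f : ℝ → X → X} {a h : ℝ} {x₀ : X}
  {B : NNReal}

/-- The vertices of the Euler polygon of step size `h` for `x' = f (t, x)`, `x a = x₀`. As `f` is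
only measurable in time, a step integrates `f` in time instead of sampling it. -/
noncomputable def eulerVertex (f : ℝ → X → X) (a h : ℝ) (x₀ : X) : ℕ → X
  | 0 => x₀
  | j + 1 => eulerVertex f a h x₀ j +
      ∫ s in (a + j * h)..(a + (j + 1 : ℕ) * h), f s (eulerVertex f a h x₀ j)

/-- The step function whose value at `s` is the last vertex of the Euler polygon before `s`. -/
noncomputable def eulerStep (f : ℝ → X → X) (a h : ℝ) (x₀ : X) (s : ℝ) : X :=
  eulerVertex f a h x₀ ⌊(s - a) / h⌋₊

/-- The Euler polygon of step size `h` for `x' = f (t, x)`, `x a = x₀`. -/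
noncomputable def eulerPolygon (f : ℝ → X → X) (a h : ℝ) (x₀ : X) (t : ℝ) : X :=
  x₀ + ∫ s in a..t, f s (eulerStep f a h x₀ s)

theorem aestronglyMeasurable_eulerStep (hmeas : ∀ x, AEStronglyMeasurable (fun t => f t x) volume) :
    AEStronglyMeasurable (fun s => f s (eulerStep f a h x₀ s)) volume := by
  have hfloor : Measurable fun s : ℝ => ⌊(s - a) / h⌋₊ :=
    Nat.measurable_floor.comp ((measurable_id.sub_const a).div_const h)
  have hcover : (⋃ j : ℕ, {s : ℝ | ⌊(s - a) / h⌋₊ = j}) = Set.univ := by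
    ext s; simp
  rw [← Measure.restrict_univ (μ := (volume : Measure ℝ)), ← hcover,
    aestronglyMeasurable_iUnion_iff]
  intro j
  refine (hmeas (eulerVertex f a h x₀ j)).restrict.congr ?_
  refine (ae_restrict_iff' (hfloor (measurableSet_singleton j))).2 (ae_of_all _ fun s hs => ?_)
  simp only [eulerStep, show ⌊(s - a) / h⌋₊ = j from hs]

theorem lipschitzWith_eulerPolygon (hmeas : ∀ x, AEStronglyMeasurable (fun t => f t x) volume)
    (hB : ∀ t x, ‖f t x‖ ≤ B) : LipschitzWith B (eulerPolygon f a h x₀) := by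
  refine LipschitzWith.of_dist_le_mul fun t u => ?_
  rw [eulerPolygon, eulerPolygon, dist_add_left]
  exact (lipschitzWith_integral (aestronglyMeasurable_eulerStep hmeas) (fun _ => hB _ _)
    a).dist_le_mul t u

theorem eulerStep_eq_eulerVertex (hh : 0 < h) {j : ℕ} {s : ℝ}
    (hs : s ∈ Set.Ico (a + j * h) (a + (j + 1 : ℕ) * h)) :
    eulerStep f a h x₀ s = eulerVertex f a h x₀ j := by
  have hj : (j : ℝ) ≤ (s - a) / h := by rw [le_div_iff₀ hh]; linarith [hs.1]
  have hj' : (s - a) / h < (j + 1 : ℕ) := by rw [div_lt_iff₀ hh]; linarith [hs.2]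
  rw [eulerStep, (Nat.floor_eq_iff ((Nat.cast_nonneg j).trans hj)).2 ⟨hj, by exact_mod_cast hj'⟩]

theorem eulerPolygon_vertex (hh : 0 < h) (hmeas : ∀ x, AEStronglyMeasurable (fun t => f t x) volume)
    (hB : ∀ t x, ‖f t x‖ ≤ B) (j : ℕ) :
    eulerPolygon f a h x₀ (a + j * h) = eulerVertex f a h x₀ j := by
  have hint : ∀ c d, IntervalIntegrable (fun s => f s (eulerStep f a h x₀ s)) volume c d :=
    intervalIntegrable_of_norm_le (aestronglyMeasurable_eulerStep hmeas) fun _ => hB _ _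
  induction j with
  | zero => simp [eulerPolygon, eulerVertex]
  | succ j ih =>
    rw [eulerPolygon, ← intervalIntegral.integral_add_adjacent_intervals (hint a (a + j * h))
      (hint _ _), ← add_assoc, ← eulerPolygon, ih, eulerVertex]
    refine congrArg _ (intervalIntegral.integral_congr_ae ?_)
    filter_upwards [Measure.ae_ne volume (a + (j + 1 : ℕ) * h)] with s hs hmem
    rw [Set.uIoc_of_le (by gcongr; exact j.le_succ)] at hmem
    rw [eulerStep_eq_eulerVertex hh ⟨hmem.1.le, lt_of_le_of_ne hmem.2 hs⟩]

theorem dist_eulerPolygon_eulerStep_le (hh : 0 < h)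
    (hmeas : ∀ x, AEStronglyMeasurable (fun t => f t x) volume) (hB : ∀ t x, ‖f t x‖ ≤ B)
    {t : ℝ} (ht : a ≤ t) :
    dist (eulerPolygon f a h x₀ t) (eulerStep f a h x₀ t) ≤ B * h := by
  rw [eulerStep, ← eulerPolygon_vertex hh hmeas hB]
  refine ((lipschitzWith_eulerPolygon hmeas hB).dist_le_mul _ _).trans
    (mul_le_mul_of_nonneg_left ?_ B.2)
  have hle := Nat.floor_le (div_nonneg (sub_nonneg.2 ht) hh.le)
  have hlt := Nat.lt_floor_add_one ((t - a) / h)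
  rw [le_div_iff₀ hh] at hle
  rw [div_lt_iff₀ hh] at hlt
  rw [Real.dist_eq, abs_le]
  constructor <;> linarith

theorem exists_subseq_tendsto_of_lipschitzWith {Y : Type*} [MetricSpace Y] [ProperSpace Y]
    {u : ℕ → ℝ → Y} {y₀ : Y} {b : ℝ} (hab : a ≤ b) (hu : ∀ k, LipschitzWith B (u k))
    (hua : ∀ k, u k a = y₀) :
    ∃ (y : ℝ → Y) (φ : ℕ → ℕ), StrictMono φ ∧
      ∀ t ∈ Set.Icc a b, Tendsto (fun k => u (φ k) t) atTop (𝓝 (y t)) := by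
  let v : ℕ → BoundedContinuousFunction (Set.Icc a b) Y := fun k =>
    BoundedContinuousFunction.mkOfCompact ⟨fun t => u k t,
      (hu k).continuous.comp continuous_subtype_val⟩
  have hcompact : IsCompact (closure (Set.range v)) := by
    refine BoundedContinuousFunction.arzela_ascoli (Metric.closedBall y₀ (B * (b - a)))
      (isCompact_closedBall _ _) _ ?_ ?_
    · rintro _ t ⟨k, rfl⟩
      rw [Metric.mem_closedBall, ← hua k]
      refine ((hu k).dist_le_mul t a).trans (mul_le_mul_of_nonneg_left ?_ B.2)
      rw [Real.dist_eq, abs_of_nonneg (sub_nonneg.2 t.2.1)]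
      linarith [t.2.2]
    · refine (LipschitzWith.uniformEquicontinuous _ B ?_).equicontinuous
      rintro ⟨_, k, rfl⟩
      exact LipschitzWith.of_dist_le_mul fun t s => (hu k).dist_le_mul t s
  obtain ⟨y, -, φ, hφ, hy⟩ := hcompact.tendsto_subseq fun k => subset_closure ⟨k, rfl⟩
  refine ⟨fun t => y (Set.projIcc a b hab t), φ, hφ, fun t ht => ?_⟩
  simp only [Set.projIcc_of_mem hab ht]
  exact (BoundedContinuousFunction.tendsto_iff_tendstoUniformly.1 hy).tendsto_at ⟨t, ht⟩

theorem isSolution_of_tendsto {b : ℝ} {c : ℕ → ℝ → X} {x : ℝ → X} (hab : a < b)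
    (hcont : ∀ t, Continuous (f t)) (hB : ∀ t x, ‖f t x‖ ≤ B)
    (hmeas : ∀ k, AEStronglyMeasurable (fun s => f s (c k s)) volume)
    (hc : ∀ t ∈ Set.Icc a b, Tendsto (fun k => c k t) atTop (𝓝 (x t)))
    (hx : ∀ t ∈ Set.Icc a b,
      Tendsto (fun k => x a + ∫ s in a..t, f s (c k s)) atTop (𝓝 (x t))) :
    IsSolution Set.univ f a b x := by
  have hfc : ∀ t ∈ Set.Icc a b, Tendsto (fun k => f t (c k t)) atTop (𝓝 (f t (x t))) :=
    fun t ht => ((hcont t).tendsto _).comp (hc t ht)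
  have hfx : AEStronglyMeasurable (fun s => f s (x s)) (volume.restrict (Set.Icc a b)) :=
    aestronglyMeasurable_of_tendsto_ae atTop (fun k => (hmeas k).restrict)
      ((ae_restrict_iff' measurableSet_Icc).2 (ae_of_all _ hfc))
  refine ⟨EReal.coe_lt_coe_iff.2 hab, fun _ _ => Set.mem_univ _, fun t ht => ?_, fun t ht => ?_⟩ <;>
    rw [timeInterval_coe] at ht
  · refine (intervalIntegrable_const (c := (B : ℝ))).mono_fun ?_ (ae_of_all _ fun s =>
      (hB _ _).trans (Real.le_norm_self _))
    rw [Set.uIoc_of_le ht.1]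
    exact hfx.mono_measure (Measure.restrict_mono
      (Set.Ioc_subset_Icc_self.trans (Set.Icc_subset_Icc_right ht.2.le)) le_rfl)
  · refine tendsto_nhds_unique (hx t ⟨ht.1, ht.2.le⟩) (tendsto_const_nhds.add ?_)
    refine intervalIntegral.tendsto_integral_filter_of_dominated_convergence (fun _ => (B : ℝ))
      (Eventually.of_forall fun k => (hmeas k).restrict)
      (Eventually.of_forall fun k => ae_of_all _ fun s _ => hB _ _) intervalIntegrable_const
      (ae_of_all _ fun s hs => hfc s ?_)
    rw [Set.uIoc_of_le ht.1] at hs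
    exact ⟨hs.1.le, hs.2.trans ht.2.le⟩

theorem exists_isSolution_of_bounded [FiniteDimensional ℝ X] {b : ℝ} (hab : a < b)
    (hmeas : ∀ x, AEStronglyMeasurable (fun t => f t x) volume) (hcont : ∀ t, Continuous (f t))
    (hB : ∀ t x, ‖f t x‖ ≤ B) (x₀ : X) :
    ∃ x : ℝ → X, x a = x₀ ∧ IsSolution Set.univ f a b x := by
  have : ProperSpace X := FiniteDimensional.proper_real X
  let h : ℕ → ℝ := fun k => 1 / ((k : ℝ) + 1)
  have hh : ∀ k, 0 < h k := fun k => by positivity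
  have hpoly : ∀ k, eulerPolygon f a (h k) x₀ a = x₀ := fun k => by simp [eulerPolygon]
  obtain ⟨x, φ, hφ, hx⟩ := exists_subseq_tendsto_of_lipschitzWith hab.le
    (fun k => lipschitzWith_eulerPolygon (h := h k) (x₀ := x₀) hmeas hB) hpoly
  have hxa : x a = x₀ :=
    tendsto_nhds_unique (hx a ⟨le_rfl, hab.le⟩) (by simp only [hpoly, tendsto_const_nhds])
  have hh0 : Tendsto h atTop (𝓝 0) := tendsto_one_div_add_atTop_nhds_zero_nat
  have hmesh : Tendsto (fun k => (B : ℝ) * h (φ k)) atTop (𝓝 0) := by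
    simpa only [mul_zero, Function.comp_apply] using (hh0.comp hφ.tendsto_atTop).const_mul (B : ℝ)
  have hstep : ∀ t ∈ Set.Icc a b,
      Tendsto (fun k => eulerStep f a (h (φ k)) x₀ t) atTop (𝓝 (x t)) := fun t ht =>
    (hx t ht).congr_dist (squeeze_zero (fun _ => dist_nonneg)
      (fun k => dist_eulerPolygon_eulerStep_le (hh _) hmeas hB ht.1) hmesh)
  refine ⟨x, hxa, isSolution_of_tendsto hab hcont hB
    (fun k => aestronglyMeasurable_eulerStep hmeas) hstep fun t ht => ?_⟩
  rw [hxa]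
  exact hx t ht

/-- The retraction of a normed space onto the closed ball of radius `r > 0` about `x₀`. -/
noncomputable def radialRetraction (x₀ : X) (r : ℝ) (x : X) : X :=
  x₀ + (r / max r ‖x - x₀‖) • (x - x₀)

theorem continuous_radialRetraction {r : ℝ} (hr : 0 < r) : Continuous (radialRetraction x₀ r) :=
  continuous_const.add (Continuous.smul
    (continuous_const.div (by fun_prop) fun _ => (lt_max_of_lt_left hr).ne') (by fun_prop))

theorem radialRetraction_mem {r : ℝ} (hr : 0 < r) (x : X) :
    radialRetraction x₀ r x ∈ Metric.closedBall x₀ r := by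
  have hmax : 0 < max r ‖x - x₀‖ := lt_max_of_lt_left hr
  rw [Metric.mem_closedBall, dist_eq_norm, radialRetraction, add_sub_cancel_left, norm_smul,
    Real.norm_of_nonneg (div_nonneg hr.le hmax.le), div_mul_eq_mul_div, div_le_iff₀ hmax]
  exact mul_le_mul_of_nonneg_left (le_max_right _ _) hr.le

theorem radialRetraction_eq_self {r : ℝ} (hr : 0 < r) {x : X} (hx : x ∈ Metric.closedBall x₀ r) :
    radialRetraction x₀ r x = x := by
  rw [Metric.mem_closedBall, dist_eq_norm] at hx
  simp [radialRetraction, max_eq_left hx, hr.ne']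

theorem exists_isSolution_of_closedBall [FiniteDimensional ℝ X] {b r : ℝ} (hab : a < b)
    (hr : 0 < r) (hBr : B * (b - a) ≤ r)
    (hmeas : ∀ x ∈ Metric.closedBall x₀ r,
      AEStronglyMeasurable (fun t => f t x) (volume.restrict (Set.Icc a b)))
    (hcont : ∀ t ∈ Set.Icc a b, ContinuousOn (f t) (Metric.closedBall x₀ r))
    (hB : ∀ t ∈ Set.Icc a b, ∀ x ∈ Metric.closedBall x₀ r, ‖f t x‖ ≤ B) :
    ∃ x : ℝ → X, x a = x₀ ∧ IsSolution (Set.Icc a b ×ˢ Metric.closedBall x₀ r) f a b x := by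
  let g : ℝ → X → X := fun t x => (Set.Icc a b).indicator (fun s => f s (radialRetraction x₀ r x)) t
  have hg : ∀ t ∈ Set.Icc a b, g t = fun x => f t (radialRetraction x₀ r x) := fun t ht =>
    funext fun _ => Set.indicator_of_mem ht _
  have hg' : ∀ t ∉ Set.Icc a b, g t = 0 := fun t ht => funext fun _ => Set.indicator_of_notMem ht _
  have hgB : ∀ t x, ‖g t x‖ ≤ B := fun t x => by
    by_cases ht : t ∈ Set.Icc a b
    · rw [hg t ht]; exact hB t ht _ (radialRetraction_mem hr x)
    · simp [hg' t ht]
  have hgc : ∀ t, Continuous (g t) := fun t => by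
    by_cases ht : t ∈ Set.Icc a b
    · rw [hg t ht]
      exact (hcont t ht).comp_continuous (continuous_radialRetraction hr) (radialRetraction_mem hr)
    · rw [hg' t ht]; exact continuous_const
  obtain ⟨x, hxa, hx⟩ := exists_isSolution_of_bounded (f := g) hab
    (fun x => (aestronglyMeasurable_indicator_iff measurableSet_Icc).2
      (hmeas _ (radialRetraction_mem hr x))) hgc hgB x₀
  have hball : ∀ t ∈ timeInterval a b, x t ∈ Metric.closedBall x₀ r := fun t ht => by
    rw [Metric.mem_closedBall, dist_eq_norm, hx.eq_integral t ht, hxa, add_sub_cancel_left]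
    rw [timeInterval_coe] at ht
    refine (intervalIntegral.norm_integral_le_of_norm_le_const fun s _ => hgB s _).trans ?_
    rw [abs_of_nonneg (sub_nonneg.2 ht.1)]
    exact (mul_le_mul_of_nonneg_left (by linarith [ht.2]) B.2).trans hBr
  have hmem : ∀ t ∈ timeInterval a b, t ∈ Set.Icc a b := fun t ht =>
    Set.Ico_subset_Icc_self (timeInterval_coe (t₁ := a) b ▸ ht)
  exact ⟨x, hxa, hx.congr (fun t ht => ⟨hmem t ht, hball t ht⟩) fun t ht => by
    simp only [hg t (hmem t ht), radialRetraction_eq_self hr (hball t ht)]⟩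

theorem exists_isSolution_of_continuousOn [FiniteDimensional ℝ X] {c r : ℝ} (hac : a < c)
    (hr : 0 < r)
    (hmeas : ∀ x ∈ Metric.closedBall x₀ r,
      AEStronglyMeasurable (fun t => f t x) (volume.restrict (Set.Icc a c)))
    (hcont : ∀ t ∈ Set.Icc a c, ContinuousOn (f t) (Metric.closedBall x₀ r))
    (hB : ∀ t ∈ Set.Icc a c, ∀ x ∈ Metric.closedBall x₀ r, ‖f t x‖ ≤ B) :
    ∃ b : ℝ, ∃ x : ℝ → X, x a = x₀ ∧
      IsSolution (Set.Icc a c ×ˢ Metric.closedBall x₀ r) f a b x := by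
  let δ : ℝ := min (c - a) (r / (B + 1))
  have hδ : 0 < δ := lt_min (sub_pos.2 hac) (by positivity)
  have hsub : Set.Icc a (a + δ) ⊆ Set.Icc a c := Set.Icc_subset_Icc_right (by
    linarith [min_le_left (c - a) (r / (B + 1))])
  have hBδ : B * (a + δ - a) ≤ r := by
    rw [add_sub_cancel_left]
    have : δ * (B + 1) ≤ r := (le_div_iff₀ (by positivity)).1 (min_le_right _ _)
    linarith
  obtain ⟨x, hxa, hx⟩ := exists_isSolution_of_closedBall (lt_add_of_pos_right a hδ) hr hBδ
    (fun x hx => (hmeas x hx).mono_measure (Measure.restrict_mono hsub le_rfl))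
    (fun t ht => hcont t (hsub ht)) (fun t ht => hB t (hsub ht))
  exact ⟨a + δ, x, hxa, hx.congr (fun t ht => ⟨hsub (hx.mem_domain t ht).1,
    (hx.mem_domain t ht).2⟩) fun _ _ => rfl⟩

end Peano

/-! ### Solutions with dissipated energy -/

section Energy

variable {X ι : Type*} [NormedAddCommGroup X] [NormedSpace ℝ X] [Fintype ι]
  {Ω : Set (ℝ × X)} {f : ℝ → X → X} {t₁ b A B : ℝ} {ω : EReal} {x : ℝ → X}

namespace IsSolution

theorem integrable_sum_mul (hx : IsSolution Ω f t₁ ω x) (φ : ι → X →L[ℝ] ℝ) {t : ℝ}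
    (ht : t ∈ timeInterval t₁ ω) :
    IntervalIntegrable (fun s => ∑ i, φ i (x s) * φ i (f s (x s))) volume t₁ t := by
  have hi : ∀ i, IntervalIntegrable (fun s => φ i (x s) * φ i (f s (x s))) volume t₁ t := fun i =>
    IntervalIntegrable.continuousOn_mul
      ⟨(φ i).integrable_comp (hx.integrable t ht).1, (φ i).integrable_comp (hx.integrable t ht).2⟩
      ((φ i).continuous.comp_continuousOn (Set.uIcc_of_le ht.1 ▸ hx.continuousOn_Icc ht))
  simpa only [Finset.sum_fn] using IntervalIntegrable.sum Finset.univ fun i _ => hi i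

theorem integral_sum_mul [CompleteSpace X] (hx : IsSolution Ω f t₁ ω x) (φ : ι → X →L[ℝ] ℝ) {t : ℝ}
    (ht : t ∈ timeInterval t₁ ω) :
    ∫ s in t₁..t, ∑ i, φ i (x s) * φ i (f s (x s)) =
      ∑ i, (φ i (x t) ^ 2 - φ i (x t₁) ^ 2) / 2 := by
  rw [intervalIntegral.integral_finsetSum fun i _ => by
    simpa using hx.integrable_sum_mul (fun _ : Unit => φ i) ht]
  refine Finset.sum_congr rfl fun i _ => integral_primitive_mul ht.1
    ⟨(φ i).integrable_comp (hx.integrable t ht).1, (φ i).integrable_comp (hx.integrable t ht).2⟩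
    fun s hs => ?_
  have hs' := mem_timeInterval_of_le ht hs.1 hs.2
  conv_lhs => rw [hx.eq_integral s hs', map_add,
    ← (φ i).intervalIntegral_comp_comm (hx.integrable s hs')]

theorem intervalIntegrable_of_norm_le_sub_energy [CompleteSpace X] (hx : IsSolution Ω f t₁ b x)
    (φ : ι → X →L[ℝ] ℝ) (hB : 0 ≤ B)
    (h : ∀ t ∈ Set.Ico t₁ b, ‖f t (x t)‖ ≤ A - B * ∑ i, φ i (x t) * φ i (f t (x t))) :
    IntervalIntegrable (fun s => f s (x s)) volume t₁ b := by
  have hlt : t₁ < b := EReal.coe_lt_coe_iff.1 hx.lt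
  rw [intervalIntegrable_iff_integrableOn_Ioc_of_le hlt.le]
  obtain ⟨T, -, hT, hT_lim⟩ := exists_seq_strictMono_tendsto' hlt
  have hT_mem : ∀ k, T k ∈ timeInterval t₁ b := fun k =>
    timeInterval_coe b ▸ ⟨(hT k).1.le, (hT k).2⟩
  refine integrableOn_Ioc_of_intervalIntegral_norm_bounded_right (l := atTop) (b := T)
    (I := |A| * (b - t₁) + B * ∑ i, φ i (x t₁) ^ 2 / 2) (fun k => ?_) hT_lim
    (Eventually.of_forall fun k => ?_)
  · exact (intervalIntegrable_iff_integrableOn_Ioc_of_le (hT k).1.le).1 (hx.integrable _ (hT_mem k))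
  have henergy : -∑ i, φ i (x t₁) ^ 2 / 2 ≤
      ∫ s in t₁..T k, ∑ i, φ i (x s) * φ i (f s (x s)) := by
    rw [hx.integral_sum_mul φ (hT_mem k), ← Finset.sum_neg_distrib]
    exact Finset.sum_le_sum fun i _ => by linarith [sq_nonneg (φ i (x (T k)))]
  have hint := (hx.integrable_sum_mul φ (hT_mem k)).const_mul B
  rw [← intervalIntegral.integral_of_le (hT k).1.le]
  calc ∫ s in t₁..T k, ‖f s (x s)‖
      ≤ ∫ s in t₁..T k, (A - B * ∑ i, φ i (x s) * φ i (f s (x s))) :=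
        intervalIntegral.integral_mono_on (hT k).1.le (hx.integrable _ (hT_mem k)).norm
          (intervalIntegrable_const.sub hint) fun s hs => h s ⟨hs.1, hs.2.trans_lt (hT k).2⟩
    _ = A * (T k - t₁) - B * ∫ s in t₁..T k, ∑ i, φ i (x s) * φ i (f s (x s)) := by
        rw [intervalIntegral.integral_sub intervalIntegrable_const hint,
          intervalIntegral.integral_const, intervalIntegral.integral_const_mul, smul_eq_mul,
          mul_comm A]
    _ ≤ |A| * (b - t₁) + B * ∑ i, φ i (x t₁) ^ 2 / 2 := by
        have h₁ : A * (T k - t₁) ≤ |A| * (b - t₁) :=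
          mul_le_mul (le_abs_self A) (sub_le_sub_right (hT k).2.le t₁)
            (sub_nonneg.2 (hT k).1.le) (abs_nonneg A)
        have h₂ := mul_le_mul_of_nonneg_left henergy hB
        linarith

end IsSolution

end Energy

/-! ### Comparison functions -/

section Comparison

theorem IsClassK.nonneg {α : ℝ → ℝ} (hα : IsClassK α) {r : ℝ} (hr : 0 ≤ r) : 0 ≤ α r :=
  hα.map_zero ▸ hα.strictMonoOn.monotoneOn Set.self_mem_Ici hr hr

theorem IsClassK.mono {α : ℝ → ℝ} (hα : IsClassK α) {r s : ℝ} (hr : 0 ≤ r) (hrs : r ≤ s) :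
    α r ≤ α s :=
  hα.strictMonoOn.monotoneOn hr (hr.trans hrs) hrs

section Dilation

variable {k : ℝ → ℝ} {r s : ℝ}

theorem intervalIntegrable_dilation (hk : Monotone k) (hr : 0 ≤ r) :
    IntervalIntegrable (fun u => k (r * u)) volume 1 2 :=
  (hk.comp fun _ _ h => mul_le_mul_of_nonneg_left h hr).intervalIntegrable

theorem integral_dilation_mono (hk : Monotone k) (hr : 0 ≤ r) (hrs : r ≤ s) :
    ∫ u in (1 : ℝ)..2, k (r * u) ≤ ∫ u in (1 : ℝ)..2, k (s * u) :=
  intervalIntegral.integral_mono_on one_le_two (intervalIntegrable_dilation hk hr)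
    (intervalIntegrable_dilation hk (hr.trans hrs)) fun u hu =>
      hk (mul_le_mul_of_nonneg_right hrs (by linarith [hu.1]))

theorem le_integral_dilation (hk : Monotone k) (hr : 0 ≤ r) :
    k r ≤ ∫ u in (1 : ℝ)..2, k (r * u) :=
  calc k r = ∫ _ in (1 : ℝ)..2, k r := by rw [intervalIntegral.integral_const]; norm_num
    _ ≤ ∫ u in (1 : ℝ)..2, k (r * u) :=
      intervalIntegral.integral_mono_on one_le_two intervalIntegrable_const
        (intervalIntegrable_dilation hk hr) fun _ hu => hk (le_mul_of_one_le_right hr hu.1)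

theorem integral_dilation_le (hk : Monotone k) (hr : 0 ≤ r) :
    ∫ u in (1 : ℝ)..2, k (r * u) ≤ k (r * 2) :=
  calc ∫ u in (1 : ℝ)..2, k (r * u) ≤ ∫ _ in (1 : ℝ)..2, k (r * 2) :=
      intervalIntegral.integral_mono_on one_le_two (intervalIntegrable_dilation hk hr)
        intervalIntegrable_const fun _ hu => hk (mul_le_mul_of_nonneg_left hu.2 hr)
    _ = k (r * 2) := by rw [intervalIntegral.integral_const]; norm_num

theorem continuousAt_integral_dilation (hk : Monotone k) (hr : 0 < r) :
    ContinuousAt (fun r => ∫ u in (1 : ℝ)..2, k (r * u)) r := by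
  have hki : ∀ c d, IntervalIntegrable k volume c d := fun c d => hk.intervalIntegrable
  have hK : Continuous fun r => ∫ u in (0 : ℝ)..r, k u :=
    intervalIntegral.continuous_primitive hki 0
  have hcont : ContinuousAt
      (fun r => r⁻¹ * ((∫ u in (0 : ℝ)..r * 2, k u) - ∫ u in (0 : ℝ)..r * 1, k u)) r :=
    (continuousAt_inv₀ hr.ne').mul ((hK.comp (continuous_mul_const 2)).sub
      (hK.comp (continuous_mul_const 1))).continuousAt
  refine hcont.congr ?_
  filter_upwards [lt_mem_nhds hr] with s hs
  rw [intervalIntegral.integral_comp_mul_left k hs.ne',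
    intervalIntegral.integral_interval_sub_left (hki _ _) (hki _ _), smul_eq_mul]

end Dilation

theorem tendsto_mul_const_nhdsGE_zero {c : ℝ} (hc : 0 ≤ c) :
    Tendsto (fun r => r * c) (𝓝[≥] 0) (𝓝[≥] 0) :=
  tendsto_nhdsWithin_iff.2
    ⟨((continuous_mul_const c).tendsto' _ _ (zero_mul c)).mono_left inf_le_left,
      eventually_mem_nhdsWithin.mono fun _ hr => mul_nonneg hr hc⟩

theorem exists_isClassKInfty_ge {g : ℝ → ℝ} (hmono : MonotoneOn g (Set.Ici 0))
    (hcont : ContinuousWithinAt g (Set.Ici 0) 0) (hzero : g 0 = 0) :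
    ∃ γ, IsClassKInfty γ ∧ ∀ r, 0 ≤ r → g r ≤ γ r := by
  let k : ℝ → ℝ := fun r => g (max r 0)
  have hk : Monotone k := fun r s hrs =>
    hmono (le_max_right r 0) (le_max_right s 0) (max_le_max_right 0 hrs)
  have hkg : ∀ r, 0 ≤ r → k r = g r := fun r hr => by simp only [k, max_eq_left hr]
  -- Averaging over `[r, 2 r]` makes `g` continuous, and adding `r` makes it strictly increasing.
  let J : ℝ → ℝ := fun r => ∫ u in (1 : ℝ)..2, k (r * u)
  have hJ_ge : ∀ r, 0 ≤ r → g r ≤ J r := fun r hr => hkg r hr ▸ le_integral_dilation hk hr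
  have hJ_zero : J 0 = 0 := by simp [J, hkg, hzero]
  have hJ_nonneg : ∀ r, 0 ≤ r → 0 ≤ J r := fun r hr =>
    (hzero.ge.trans (hmono Set.self_mem_Ici hr hr)).trans (hJ_ge r hr)
  have hJ_cont : ContinuousOn J (Set.Ici 0) := fun r hr => by
    rcases (show (0 : ℝ) ≤ r from hr).eq_or_lt with rfl | hr
    · rw [ContinuousWithinAt, hJ_zero]
      rw [ContinuousWithinAt, hzero] at hcont
      refine tendsto_of_tendsto_of_tendsto_of_le_of_le' tendsto_const_nhds
        (hcont.comp (tendsto_mul_const_nhdsGE_zero zero_le_two))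
        (eventually_mem_nhdsWithin.mono hJ_nonneg) (eventually_mem_nhdsWithin.mono fun r hr => ?_)
      exact (integral_dilation_le hk hr).trans_eq (hkg (r * 2) (mul_nonneg hr zero_le_two))
    · exact (continuousAt_integral_dilation hk hr).continuousWithinAt
  refine ⟨fun r => r + J r,
    ⟨⟨continuousOn_id.add hJ_cont, fun r hr s _ hrs => ?_, by simp [hJ_zero]⟩, ?_⟩,
    fun r hr => (hJ_ge r hr).trans (le_add_of_nonneg_left hr)⟩
  · exact add_lt_add_of_lt_of_le hrs (integral_dilation_mono hk hr hrs.le)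
  · refine tendsto_atTop_mono' atTop ?_ tendsto_id
    filter_upwards [eventually_ge_atTop 0] with r hr
    exact le_add_of_nonneg_right (hJ_nonneg r hr)

/- The best gain is the infimum over `T` of the trade-off between forgetting the state before the
last `T` units of time and the weighted input during these; it is continuous at `0` because `T` can
be chosen first. -/
theorem exists_gain_of_forall_le_add {β : ℝ → ℝ → ℝ} {α w : ℝ → ℝ} {R : ℝ} (hβ : IsClassKL β)
    (hα : IsClassK α) (hw : ∀ T, 0 ≤ T → 0 < w T) (hR : 0 ≤ R) :
    ∃ γ, IsClassKInfty γ ∧ ∀ D, 0 ≤ D → ∀ v : ℝ,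
      (∀ T, 0 ≤ T → v ≤ β R T + α (D / w T)) → v ≤ γ D := by
  let g : ℝ → ℝ := fun D => ⨅ T : Set.Ici (0 : ℝ), (β R T + α (D / w T))
  have hterm : ∀ D, 0 ≤ D → ∀ T : Set.Ici (0 : ℝ), 0 ≤ β R T + α (D / w T) := fun D hD T =>
    add_nonneg ((hβ.isClassK T T.2).nonneg hR) (hα.nonneg (div_nonneg hD (hw T T.2).le))
  have hbdd : ∀ D, 0 ≤ D →
      BddBelow (Set.range fun T : Set.Ici (0 : ℝ) => β R T + α (D / w T)) := fun D hD =>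
    ⟨0, Set.forall_mem_range.2 (hterm D hD)⟩
  have hg_mono : MonotoneOn g (Set.Ici 0) := fun D hD D' _ h => ciInf_mono (hbdd D hD) fun T => by
    have hT := (hw T T.2).le
    gcongr
    exact hα.mono (div_nonneg hD hT) (div_le_div_of_nonneg_right h hT)
  have hg_nonneg : ∀ D, 0 ≤ D → 0 ≤ g D := fun D hD => Real.iInf_nonneg (hterm D hD)
  have hg_lt : ∀ ε, 0 < ε → ∀ᶠ D in 𝓝[≥] 0, g D < ε := fun ε hε => by
    obtain ⟨T, hT_lt, hT⟩ := (((hβ.tendsto_zero R hR).eventually (gt_mem_nhds hε)).and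
      (eventually_ge_atTop 0)).exists
    have hα_cont : Tendsto (fun D => β R T + α (D / w T)) (𝓝[≥] 0) (𝓝 (β R T)) := by
      have h := hα.continuousOn 0 Set.self_mem_Ici
      rw [ContinuousWithinAt, hα.map_zero] at h
      simpa [div_eq_mul_inv] using (h.comp
        (tendsto_mul_const_nhdsGE_zero (inv_nonneg.2 (hw T hT).le))).const_add (β R T)
    filter_upwards [hα_cont.eventually (gt_mem_nhds hT_lt), self_mem_nhdsWithin] with D hD hD0
    exact (ciInf_le (hbdd D hD0) ⟨T, hT⟩).trans_lt hD
  have hg_zero : g 0 = 0 := le_antisymm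
    (le_of_forall_pos_lt_add fun ε hε => by
      simpa using (hg_lt ε hε).self_of_nhdsWithin Set.self_mem_Ici) (hg_nonneg 0 le_rfl)
  have hg_cont : ContinuousWithinAt g (Set.Ici 0) 0 := by
    rw [ContinuousWithinAt, hg_zero]
    exact tendsto_order.2 ⟨fun a ha => eventually_mem_nhdsWithin.mono fun D hD =>
      ha.trans_le (hg_nonneg D hD), hg_lt⟩
  obtain ⟨γ, hγ, hle⟩ := exists_isClassKInfty_ge hg_mono hg_cont hg_zero
  exact ⟨γ, hγ, fun D hD v hv => (le_ciInf fun T : Set.Ici (0 : ℝ) => hv T T.2).trans (hle D hD)⟩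

end Comparison

/-! ### Input-to-state stability with fading memory -/

section FadingMemory

variable {X U : Type*} [NormedAddCommGroup X] [NormedSpace ℝ X] [NormedAddCommGroup U]
  {f : ℝ → X → U → X} {β : ℝ → ℝ → ℝ} {α w : ℝ → ℝ} {A : Set X} {t₀ t₁ t₂ t M P Q T : ℝ}
  {u : ℝ → U} {x : ℝ → X}

theorem IsLocEssBounded.mono (hu : IsLocEssBounded t₁ u) (h : t₁ ≤ t₂) : IsLocEssBounded t₂ u :=
  fun T => (hu T).mono_measure (Measure.restrict_mono (Set.Icc_subset_Icc_left h) le_rfl)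

theorem le_iSup_mul_div {b : ℝ → ℝ} (hb : ∀ s ∈ Set.Ico t₁ t, b s ∈ Set.Icc 0 P)
    (hw : ∀ T, 0 ≤ T → 0 < w T) (hw_anti : AntitoneOn w (Set.Ici 0)) {s : ℝ}
    (hs : s ∈ Set.Ico t₁ t) (hT : t - s ≤ T) :
    b s ≤ (⨆ s : Set.Ico t₁ t, b s * w (t - s)) / w T := by
  have ht : ∀ {s}, s ∈ Set.Ico t₁ t → 0 ≤ t - s := fun hs => sub_nonneg.2 hs.2.le
  have hbdd : BddAbove (Set.range fun s : Set.Ico t₁ t => b s * w (t - s)) :=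
    ⟨P * w 0, Set.forall_mem_range.2 fun s => mul_le_mul (hb s s.2).2
      (hw_anti Set.self_mem_Ici (ht s.2) (ht s.2)) (hw _ (ht s.2)).le
      ((hb s s.2).1.trans (hb s s.2).2)⟩
  have hT0 := (ht hs).trans hT
  rw [le_div_iff₀ (hw T hT0)]
  exact (mul_le_mul_of_nonneg_left (hw_anti (ht hs) hT0 hT) (hb s hs).1).trans
    (le_ciSup hbdd ⟨s, hs⟩)

namespace IsISS

theorem infDist_le_of_norm_le (hISS : IsISS t₀ f β α A) (ht₁ : t₀ ≤ t₁)
    (hu : IsLocEssBounded t₁ u)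
    (hx : IsSolution Set.univ (fun t ξ => f t ξ (u t)) t₁ ⊤ x) (ht : t₁ ≤ t) (hQ : 0 ≤ Q)
    (huQ : ∀ s ∈ Set.Ico t₁ t, ‖u s‖ ≤ Q) :
    Metric.infDist (x t) A ≤ β (Metric.infDist (x t₁) A) (t - t₁) + α Q := by
  refine (hISS.estimate t₁ ht₁ u x hu hx t ht).trans
    (add_le_add_right (hISS.isClassKInfty.toIsClassK.mono ENNReal.toReal_nonneg
      (ENNReal.toReal_le_of_le_ofReal hQ ?_)) _)
  rw [eLpNorm_exponent_top]
  exact eLpNormEssSup_le_of_ae_bound (ae_restrict_of_forall_mem measurableSet_Ico huQ)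

theorem infDist_le_of_restart (hISS : IsISS t₀ f β α A) (ht₁ : t₀ ≤ t₁)
    (hu : IsLocEssBounded t₁ u)
    (hx : IsSolution Set.univ (fun t ξ => f t ξ (u t)) t₁ ⊤ x) (h₁₂ : t₁ ≤ t₂) (ht : t₂ ≤ t)
    (hM : Metric.infDist (x t₁) A ≤ M) (hP : 0 ≤ P) (huP : ∀ s ∈ Set.Ico t₁ t₂, ‖u s‖ ≤ P)
    (hQ : 0 ≤ Q) (huQ : ∀ s ∈ Set.Ico t₂ t, ‖u s‖ ≤ Q) :
    Metric.infDist (x t) A ≤ β (β M 0 + α P) (t - t₂) + α Q := by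
  have hβ := hISS.isClassKL
  have hforget : β (Metric.infDist (x t₁) A) (t₂ - t₁) ≤ β M 0 :=
    (hβ.antitoneOn _ Metric.infDist_nonneg Set.self_mem_Ici (sub_nonneg.2 h₁₂)
      (sub_nonneg.2 h₁₂)).trans ((hβ.isClassK 0 le_rfl).mono Metric.infDist_nonneg hM)
  have hrestart : Metric.infDist (x t₂) A ≤ β M 0 + α P :=
    (hISS.infDist_le_of_norm_le ht₁ hu hx h₁₂ hP huP).trans (add_le_add_left hforget _)
  exact (hISS.infDist_le_of_norm_le (ht₁.trans h₁₂) (hu.mono h₁₂)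
    (hx.restart (timeInterval_top (t₁ := t₁) ▸ h₁₂)) ht hQ huQ).trans (add_le_add_left
      ((hβ.isClassK _ (sub_nonneg.2 ht)).mono Metric.infDist_nonneg hrestart) _)

theorem exists_fadingMemory_gain (hISS : IsISS t₀ f β α A) (hM : 0 ≤ M) (hP : 0 ≤ P)
    (hw : ∀ T, 0 ≤ T → 0 < w T) (hw_anti : AntitoneOn w (Set.Ici 0)) :
    ∃ γ, IsClassKInfty γ ∧ ∀ t₁, t₀ ≤ t₁ → ∀ (u : ℝ → U) (x : ℝ → X) (b : ℝ → ℝ),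
      IsLocEssBounded t₁ u → IsSolution Set.univ (fun t ξ => f t ξ (u t)) t₁ ⊤ x →
      (∀ s, t₁ ≤ s → ‖u s‖ ≤ b s ∧ b s ≤ P) → Metric.infDist (x t₁) A ≤ M → ∀ t, t₁ ≤ t →
      Metric.infDist (x t) A ≤ β (Metric.infDist (x t₁) A) (t - t₁) +
        γ (⨆ s : Set.Ico t₁ t, b s * w (t - s)) := by
  have hβ := hISS.isClassKL
  have hα := hISS.isClassKInfty.toIsClassK
  have hR : 0 ≤ β M 0 + α P := add_nonneg ((hβ.isClassK 0 le_rfl).nonneg hM) (hα.nonneg hP)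
  obtain ⟨γ, hγ, hgain⟩ := exists_gain_of_forall_le_add hβ hα hw hR
  refine ⟨γ, hγ, fun t₁ ht₁ u x b hu hx hb hM₁ t ht => ?_⟩
  set D := ⨆ s : Set.Ico t₁ t, b s * w (t - s)
  have hb0 : ∀ s, t₁ ≤ s → 0 ≤ b s := fun s hs => (norm_nonneg _).trans (hb s hs).1
  have hD : 0 ≤ D := Real.iSup_nonneg fun s =>
    mul_nonneg (hb0 s s.2.1) (hw _ (sub_nonneg.2 s.2.2.le)).le
  have hβ0 := (hβ.isClassK _ (sub_nonneg.2 ht)).nonneg (Metric.infDist_nonneg (x := x t₁) (s := A))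
  rw [← sub_le_iff_le_add']
  refine hgain D hD _ fun T hT => ?_
  have hDT : 0 ≤ D / w T := div_nonneg hD (hw T hT).le
  have hrecent : ∀ s ∈ Set.Ico t₁ t, t - s ≤ T → ‖u s‖ ≤ D / w T := fun s hs hsT =>
    (hb s hs.1).1.trans
      (le_iSup_mul_div (fun s hs => ⟨hb0 s hs.1, (hb s hs.1).2⟩) hw hw_anti hs hsT)
  rcases le_or_gt t₁ (t - T) with h | h
  · have := hISS.infDist_le_of_restart ht₁ hu hx h (sub_le_self t hT) hM₁ hP
      (fun s hs => (hb s hs.1).1.trans (hb s hs.1).2) hDT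
      fun s hs => hrecent s ⟨h.trans hs.1, hs.2⟩ (by linarith [hs.1])
    rw [sub_sub_cancel] at this
    linarith
  · have := hISS.infDist_le_of_norm_le ht₁ hu hx ht hDT
      fun s hs => hrecent s hs (by linarith [hs.1])
    linarith [(hβ.isClassK T hT).nonneg hR]

end IsISS

end FadingMemory

/-! ### Regular vector fields -/

namespace IsRegularField

variable {E E' E₁ E₂ : Type*} [PseudoMetricSpace E] [PseudoMetricSpace E']
  [NormedAddCommGroup E₁] [NormedAddCommGroup E₂] {t₀ t : ℝ}

theorem continuous [ProperSpace E] {f : ℝ → E → E₂} (hf : IsRegularField t₀ f) (ht : t₀ ≤ t) :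
    Continuous (f t) := by
  refine continuous_iff_continuousAt.2 fun x => ?_
  obtain ⟨L, hL⟩ := hf.lipschitz _ (isCompact_closedBall x 1) t
  exact (hL t ⟨ht, le_rfl⟩).continuousOn.continuousAt (Metric.closedBall_mem_nhds x one_pos)

theorem comp {f : ℝ → E → E₂} (hf : IsRegularField t₀ f) {φ : E' → E} {C : NNReal}
    (hφ : LipschitzWith C φ) : IsRegularField t₀ (fun t x => f t (φ x)) where
  measurable x := hf.measurable (φ x)
  lipschitz K hK T := by
    obtain ⟨L, hL⟩ := hf.lipschitz _ (hK.image hφ.continuous) T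
    exact ⟨L * C, fun t ht => (hL t ht).comp hφ.lipschitzOnWith (Set.mapsTo_image φ K)⟩
  bounded K hK := by
    obtain ⟨M, hM⟩ := hf.bounded _ (hK.image hφ.continuous)
    exact ⟨M, fun t ht x hx => hM t ht _ (Set.mem_image_of_mem φ hx)⟩

theorem prodMk {f : ℝ → E → E₁} {g : ℝ → E → E₂} (hf : IsRegularField t₀ f)
    (hg : IsRegularField t₀ g) : IsRegularField t₀ (fun t x => (f t x, g t x)) where
  measurable x := (hf.measurable x).prodMk (hg.measurable x)
  lipschitz K hK T := by
    obtain ⟨L₁, hL₁⟩ := hf.lipschitz K hK T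
    obtain ⟨L₂, hL₂⟩ := hg.lipschitz K hK T
    exact ⟨max L₁ L₂, fun t ht => (hL₁ t ht).prodMk (hL₂ t ht)⟩
  bounded K hK := by
    obtain ⟨M₁, hM₁⟩ := hf.bounded K hK
    obtain ⟨M₂, hM₂⟩ := hg.bounded K hK
    exact ⟨max M₁ M₂, fun t ht x hx => max_le_max (hM₁ t ht x hx) (hM₂ t ht x hx)⟩

theorem pi {ι : Type*} [Fintype ι] {Y : ι → Type*} [∀ i, NormedAddCommGroup (Y i)]
    [∀ i, SecondCountableTopology (Y i)] {f : ∀ i, ℝ → E → Y i}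
    (hf : ∀ i, IsRegularField t₀ (f i)) : IsRegularField t₀ (fun t x i => f i t x) where
  measurable x := by
    let _ : ∀ i, MeasurableSpace (Y i) := fun i => borel (Y i)
    have _ : ∀ i, BorelSpace (Y i) := fun i => ⟨rfl⟩
    exact (aemeasurable_pi_lambda _ fun i =>
      ((hf i).measurable x).aemeasurable).aestronglyMeasurable
  lipschitz K hK T := by
    choose L hL using fun i => (hf i).lipschitz K hK T
    obtain ⟨L', hL'⟩ := Finite.exists_le L
    exact ⟨L', fun t ht => LipschitzOnWith.of_dist_le_mul fun x hx y hy =>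
      (dist_pi_le_iff (by positivity)).2 fun i =>
        (((hL i t ht).weaken (hL' i)).dist_le_mul x hx y hy)⟩
  bounded K hK := by
    choose M hM using fun i => (hf i).bounded K hK
    obtain ⟨M', hM'⟩ := Finite.exists_le M
    exact ⟨max M' 0, fun t ht x hx => (pi_norm_le_iff_of_nonneg (le_max_right _ _)).2 fun i =>
      ((hM i t ht x hx).trans (hM' i)).trans (le_max_left _ _)⟩

end IsRegularField

/-! ### Antisymmetric interactions -/

section Antisymmetric

variable {ι : Type*} [Fintype ι] {f : ι → ι → ℝ}

theorem sum_sum_eq_zero_of_antisymm (hf : ∀ i j, f i j = -f j i) : ∑ i, ∑ j, f i j = 0 := by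
  have h : ∑ i, ∑ j, f i j = -∑ i, ∑ j, f i j :=
    calc ∑ i, ∑ j, f i j = ∑ j, ∑ i, f i j := Finset.sum_comm
      _ = ∑ j, ∑ i, -f j i := by simp only [← hf]
      _ = -∑ i, ∑ j, f i j := by simp only [Finset.sum_neg_distrib]
  linarith

theorem two_mul_sum_mul_sum_of_antisymm (hf : ∀ i j, f i j = -f j i) (y : ι → ℝ) :
    2 * ∑ i, y i * ∑ j, f i j = -∑ i, ∑ j, (y j - y i) * f i j := by
  have hswap : ∑ i, ∑ j, y j * f i j = -∑ i, ∑ j, y i * f i j :=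
    calc ∑ i, ∑ j, y j * f i j = ∑ j, ∑ i, y j * f i j := Finset.sum_comm
      _ = ∑ j, ∑ i, -(y j * f j i) := by simp only [← mul_neg, ← hf]
      _ = -∑ i, ∑ j, y i * f i j := by simp only [Finset.sum_neg_distrib]
  simp only [sub_mul, Finset.sum_sub_distrib, hswap, Finset.mul_sum _ (f _)]
  ring

end Antisymmetric

/-! ### Coupling functions with poles -/

theorem exists_half_abs_sub_le_mul {f : ℝ → ℝ} (hc : ContinuousOn f (Set.Ioo (-1) 1))
    (hr : Tendsto f (𝓝[<] 1) atTop) (hl : Tendsto f (𝓝[>] (-1)) atBot) :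
    ∃ C, 0 ≤ C ∧ ∀ r ∈ Set.Ioo (-1 : ℝ) 1, |f r| / 2 - C ≤ r * f r := by
  obtain ⟨u, hu, hfu⟩ := mem_nhdsLT_iff_exists_Ioo_subset.1 (hr.eventually_ge_atTop 0)
  obtain ⟨v, hv, hfv⟩ := mem_nhdsGT_iff_exists_Ioo_subset.1 (hl.eventually_le_atBot 0)
  have hsub : Set.Icc (min v (-(1 / 2))) (max u (1 / 2)) ⊆ Set.Ioo (-1) 1 :=
    Set.Icc_subset_Ioo (lt_min hv (by norm_num)) (max_lt hu (by norm_num))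
  obtain ⟨C, hC⟩ := isCompact_Icc.exists_bound_of_continuousOn (hc.mono hsub)
  refine ⟨2 * |C|, by positivity, fun r hr => ?_⟩
  rcases lt_or_ge (max u (1 / 2)) r with h | h
  · obtain ⟨hur, hr'⟩ := max_lt_iff.1 h
    have hf : 0 ≤ f r := hfu ⟨hur, hr.2⟩
    rw [abs_of_nonneg hf]
    nlinarith [abs_nonneg C]
  rcases lt_or_ge r (min v (-(1 / 2))) with h' | h'
  · obtain ⟨hrv, hr'⟩ := lt_min_iff.1 h'
    have hf : f r ≤ 0 := hfv ⟨hr.1, hrv⟩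
    rw [abs_of_nonpos hf]
    nlinarith [abs_nonneg C]
  · have hf : |f r| ≤ |C| := (hC r ⟨h', h⟩).trans (le_abs_self C)
    have hrf : |r * f r| ≤ |f r| := by
      rw [abs_mul]
      exact mul_le_of_le_one_left (abs_nonneg _) (abs_le.2 ⟨hr.1.le, hr.2.le⟩)
    linarith [neg_abs_le (r * f r), abs_nonneg C]

/-! ### Networks with saturating links -/

section Saturation

variable {V : Type*} [Finite V] {y g : V → ℝ → ℝ} {l : V → ℝ} {sat : V → V → Prop} {a b : ℝ}

theorem exists_eventually_sub_le_of_saturated (hab : a < b)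
    (hg : ∀ k, IntervalIntegrable (g k) volume a b)
    (hy : ∀ k, ∀ t ∈ Set.Ico a b, y k t = l k - ∫ s in t..b, g k s)
    (hsat : ∀ k j, sat k j → l j < l k)
    (hlower : ∀ k, (∀ j, ¬ sat k j) → ∃ C, ∀ᶠ t in 𝓝[<] b, -C ≤ g k t)
    (hstep : ∀ k j, sat k j → ∃ D, ∀ᶠ t in 𝓝[<] b, y k t - y j t ≤ l k - l j + D * (b - t))
    (k : V) : ∃ C, ∀ᶠ t in 𝓝[<] b, y k t - l k ≤ C * (b - t) := by
  have : IsTrans V fun j k => l j < l k := ⟨fun _ _ _ => lt_trans⟩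
  have : Std.Irrefl fun j k => l j < l k := ⟨fun _ => lt_irrefl _⟩
  induction k using (Finite.wellFounded_of_trans_of_irrefl fun j k => l j < l k).induction with
  | h k ih =>
    by_cases h : ∃ j, sat k j
    · obtain ⟨j, hj⟩ := h
      obtain ⟨C, hC⟩ := ih j (hsat k j hj)
      obtain ⟨D, hD⟩ := hstep k j hj
      refine ⟨C + D, ?_⟩
      filter_upwards [hC, hD] with t hCt hDt
      linarith
    · obtain ⟨C, hC⟩ := hlower k (not_exists.1 h)
      exact ⟨C, sub_le_of_eventually_ge hab (hg k) (hy k) hC⟩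

/-- A saturated node with the largest limit approaches this limit linearly, being dragged along by
the lower nodes, while its velocity tends to `-∞`. -/
theorem not_saturated (hab : a < b)
    (hg : ∀ k, IntervalIntegrable (g k) volume a b)
    (hy : ∀ k, ∀ t ∈ Set.Ico a b, y k t = l k - ∫ s in t..b, g k s)
    (hsat : ∀ k j, sat k j → l j < l k)
    (hlower : ∀ k, (∀ j, ¬ sat k j) → ∃ C, ∀ᶠ t in 𝓝[<] b, -C ≤ g k t)
    (hstep : ∀ k j, sat k j → ∃ D, ∀ᶠ t in 𝓝[<] b, y k t - y j t ≤ l k - l j + D * (b - t))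
    (hblow : ∀ k j, sat k j → (∀ i, ¬ sat i k) → Tendsto (g k) (𝓝[<] b) atBot) (k j : V) :
    ¬ sat k j := by
  intro hkj
  obtain ⟨k, ⟨j, hj⟩, hmax⟩ :=
    Set.exists_max_image {k | ∃ j, sat k j} l (Set.toFinite _) ⟨k, j, hkj⟩
  have hup : ∀ i, ¬ sat i k := fun i hi => (hmax i ⟨k, hi⟩).not_gt (hsat i k hi)
  obtain ⟨C, hC⟩ := exists_eventually_sub_le_of_saturated hab hg hy hsat hlower hstep k
  have hneg : ∀ᶠ t in 𝓝[<] b, -y k t - -l k ≤ -(C + 1) * (b - t) := by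
    refine sub_le_of_eventually_ge (y := fun t => -y k t) (g := fun t => -g k t) hab (hg k).neg
      (fun t ht => ?_) ?_
    · simp only [intervalIntegral.integral_neg, hy k t ht]
      ring
    · filter_upwards [(hblow k j hj hup).eventually_le_atBot (-(C + 1))] with t ht
      linarith
  obtain ⟨t, h₁, h₂, ht : t < b⟩ := (hC.and (hneg.and self_mem_nhdsWithin)).exists
  nlinarith

end Saturation

namespace MultiAgentSystem

variable {N m : ℕ} {n q : Fin N → ℕ} {S : MultiAgentSystem N m n q} {t₀ t : ℝ}
  {x : NetworkState m n}

/-! ### Coupling forces -/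

/-- The vector field of the agents without inputs. -/
def openLoop (S : MultiAgentSystem N m n q) (t : ℝ) (x : NetworkState m n) : NetworkState m n :=
  (fun i => S.F i t (x.1 i) (x.2 i), fun i => S.Z i t (x.2 i) (x.1 i))

open Classical in
/-- The force that agent `j` exerts on component `p` of agent `i`, which is zero when the agents are
not neighbours. -/
noncomputable def edgeForce (S : MultiAgentSystem N m n q) (p : Fin m) (i j : Fin N) (t : ℝ)
    (x : NetworkState m n) : ℝ :=
  if S.G.Adj i j then S.μ i j p ((x.1 j p - x.1 i p) / S.ψ i j p t) else 0

/-- The total force on the outputs of the agents; the gain matrices cancel in the closed loop. -/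
noncomputable def couplingForce (S : MultiAgentSystem N m n q) (t : ℝ) (x : NetworkState m n) :
    Fin N → Fin m → ℝ :=
  fun i p => ∑ j, S.edgeForce p i j t x

theorem OpenLoopAssumption.isRegularField_openLoop (h : S.OpenLoopAssumption t₀) :
    IsRegularField t₀ S.openLoop := by
  have hagent (i : Fin N) : LipschitzWith 1
      (fun x : NetworkState m n => (x.1 i, x.2 i)) :=
    ((LipschitzWith.eval i).comp LipschitzWith.prod_fst).prodMk
      ((LipschitzWith.eval i).comp LipschitzWith.prod_snd) |>.weaken (by simp)
  exact (IsRegularField.pi fun i => (h.F_regular i).comp (hagent i)).prodMk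
    (IsRegularField.pi fun i => (h.Z_regular i).comp (hagent i))

theorem edgeForce_of_adj {p : Fin m} {i j : Fin N} (h : S.G.Adj i j) :
    S.edgeForce p i j t x = S.μ i j p ((x.1 j p - x.1 i p) / S.ψ i j p t) :=
  if_pos h

theorem edgeForce_of_not_adj {p : Fin m} {i j : Fin N} (h : ¬S.G.Adj i j) :
    S.edgeForce p i j t x = 0 :=
  if_neg h

theorem closedLoop_eq (hΓ : ∀ i w, IsUnit (S.Γ i t w)) (x : NetworkState m n) :
    S.closedLoop t x = S.openLoop t x + (S.couplingForce t x, 0) := by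
  have hcancel (i : Fin N) : S.Γ i t (S.W i (x.1 i) (x.2 i)) *ᵥ S.coupling i t x =
      S.couplingForce t x i := by
    classical
    have hu := (Matrix.isUnit_iff_isUnit_det _).1 (hΓ i (S.W i (x.1 i) (x.2 i)))
    funext p
    simp only [coupling, Matrix.mulVec_mulVec, Matrix.mul_nonsing_inv _ hu, Matrix.one_mulVec,
      Finset.sum_filter, Finset.sum_apply, apply_ite (fun v : Fin m → ℝ => v p), edgeCoupling,
      Pi.sub_apply, Pi.zero_apply, couplingForce, edgeForce]
  refine Prod.ext (funext fun i => ?_) (add_zero _).symm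
  simp only [closedLoop, openLoop, hcancel, Prod.fst_add, Pi.add_apply]

theorem div_mem_Ioo_of_mem_funnel (hx : (t, x) ∈ S.funnel) {i j : Fin N} (h : S.G.Adj i j)
    (p : Fin m) : (x.1 j p - x.1 i p) / S.ψ i j p t ∈ Set.Ioo (-1 : ℝ) 1 := by
  have hlt := hx i j p h
  have hψ : 0 < S.ψ i j p t := (abs_nonneg _).trans_lt hlt
  rwa [Set.mem_Ioo, ← abs_lt, abs_div, abs_of_pos hψ, div_lt_one hψ]

theorem edgeForce_antisymm (hDesign : S.DesignAssumption t₀) (ht : t₀ ≤ t)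
    (hx : (t, x) ∈ S.funnel) (p : Fin m) (i j : Fin N) :
    S.edgeForce p i j t x = -S.edgeForce p j i t x := by
  by_cases h : S.G.Adj i j
  · rw [edgeForce_of_adj h, edgeForce_of_adj h.symm,
      ← hDesign.μ_symm i j p h _ (div_mem_Ioo_of_mem_funnel hx h.symm p),
      hDesign.ψ_symm i j p h t ht, ← neg_div, neg_sub]
  · rw [edgeForce_of_not_adj h, edgeForce_of_not_adj fun h' => h h'.symm, neg_zero]

/-! ### The blended dynamics -/

/-- The projection of a network state to a blended state which averages the outputs. -/
noncomputable def average (m : ℕ) (n : Fin N → ℕ) : NetworkState m n →L[ℝ] BlendedState m n :=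
  ((1 / (N : ℝ)) • ∑ i, ContinuousLinearMap.proj i ∘L ContinuousLinearMap.fst ℝ _ _).prod
    (ContinuousLinearMap.snd ℝ _ _)

/-- The deviations of the outputs from their average, which are the input `e` that the closed loop
feeds into the blended dynamics. -/
noncomputable def deviation (x : NetworkState m n) (i : Fin N) : Fin m → ℝ :=
  x.1 i - (average m n x).1

/-- The network state with the given average output and deviations. -/
def spread (ξ : BlendedState m n) (e : Fin N → Fin m → ℝ) : NetworkState m n :=
  (fun i => ξ.1 + e i, ξ.2)

theorem average_apply (x : NetworkState m n) :
    average m n x = ((1 / (N : ℝ)) • ∑ i, x.1 i, x.2) := by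
  simp [average]

theorem average_mk (y : Fin N → Fin m → ℝ) (z : Internal n) :
    average m n (y, z) = ((1 / (N : ℝ)) • ∑ i, y i, z) :=
  average_apply (y, z)

theorem average_fst (x : NetworkState m n) :
    (average m n x).1 = (1 / (N : ℝ)) • ∑ i, x.1 i :=
  congrArg Prod.fst (average_apply x)

theorem average_snd (x : NetworkState m n) : (average m n x).2 = x.2 :=
  congrArg Prod.snd (average_apply x)

theorem continuous_deviation : Continuous (deviation (m := m) (n := n)) := by
  unfold deviation
  fun_prop

theorem continuous_uncurry_spread : Continuous (Function.uncurry (spread (m := m) (n := n))) := by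
  unfold Function.uncurry spread
  fun_prop

theorem lipschitzWith_spread (e : Fin N → Fin m → ℝ) :
    LipschitzWith 1 (fun ξ : BlendedState m n => spread ξ e) :=
  LipschitzWith.of_dist_le_mul fun ξ η => by
    rw [NNReal.coe_one, one_mul]
    refine max_le_max ((dist_pi_le_iff dist_nonneg).2 fun i => ?_) le_rfl
    exact (dist_add_right _ _ _).le

theorem spread_average_deviation (x : NetworkState m n) :
    spread (average m n x) (deviation x) = x :=
  Prod.ext (funext fun _ => add_sub_cancel _ _) (average_snd x)

theorem blended_eq_average_openLoop (t : ℝ) (ξ : BlendedState m n) (e : Fin N → Fin m → ℝ) :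
    S.blended t ξ e = average m n (S.openLoop t (spread ξ e)) :=
  (average_mk _ _).symm

theorem average_couplingForce (hDesign : S.DesignAssumption t₀) (ht : t₀ ≤ t)
    (hx : (t, x) ∈ S.funnel) : average m n (S.couplingForce t x, 0) = 0 := by
  have hsum : ∑ i, S.couplingForce t x i = 0 := by
    funext p
    rw [Finset.sum_apply]
    exact sum_sum_eq_zero_of_antisymm (edgeForce_antisymm hDesign ht hx p)
  rw [average_mk, hsum, smul_zero, Prod.mk_zero_zero]

theorem average_closedLoop (hDesign : S.DesignAssumption t₀) (hΓ : ∀ i w, IsUnit (S.Γ i t w))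
    (ht : t₀ ≤ t) (hx : (t, x) ∈ S.funnel) :
    average m n (S.closedLoop t x) = S.blended t (average m n x) (deviation x) := by
  rw [closedLoop_eq hΓ, map_add, average_couplingForce hDesign ht hx, add_zero,
    blended_eq_average_openLoop, spread_average_deviation]

theorem exists_lipschitzOnWith_blended (hOpen : IsRegularField t₀ S.openLoop)
    {K : Set (BlendedState m n)} (hK : IsCompact K) (P T : ℝ) :
    ∃ L : NNReal, ∀ t ∈ Set.Icc t₀ T, ∀ e : Fin N → Fin m → ℝ, ‖e‖ ≤ P →
      LipschitzOnWith L (fun ξ => S.blended t ξ e) K := by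
  obtain ⟨L, hL⟩ := hOpen.lipschitz _
    ((hK.prod (isCompact_closedBall (0 : Fin N → Fin m → ℝ) P)).image continuous_uncurry_spread) T
  refine ⟨‖average m n‖₊ * (L * 1), fun t ht e he => ?_⟩
  simp only [blended_eq_average_openLoop]
  refine (average m n).lipschitz.comp_lipschitzOnWith
    ((hL t ht).comp (lipschitzWith_spread e).lipschitzOnWith fun ξ hξ => ?_)
  exact ⟨(ξ, e), ⟨hξ, mem_closedBall_zero_iff.2 he⟩, rfl⟩

/-! ### Synchronization inside the funnel -/

theorem ψ_le_Psi {i j : Fin N} (h : S.G.Adj i j) (p : Fin m) (t : ℝ) : S.ψ i j p t ≤ S.Psi t :=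
  le_ciSup (f := fun a : {a : Fin N × Fin N × Fin m // S.G.Adj a.1 a.2.1} =>
    S.ψ a.1.1 a.1.2.1 a.1.2.2 t) (Set.finite_range _).bddAbove ⟨(i, j, p), h⟩

theorem Psi_nonneg (hx : (t, x) ∈ S.funnel) : 0 ≤ S.Psi t :=
  Real.iSup_nonneg fun a => (abs_nonneg _).trans (hx _ _ _ a.2).le

theorem exists_syncBound_le (hDesign : S.DesignAssumption t₀) :
    ∃ P : ℝ, 0 ≤ P ∧ ∀ t, t₀ ≤ t → S.syncBound t ≤ P := by
  choose B hB using fun a : {a : Fin N × Fin N × Fin m // S.G.Adj a.1 a.2.1} =>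
    hDesign.ψ_bounded a.1.1 a.1.2.1 a.1.2.2 a.2
  obtain ⟨P, hP⟩ := Finite.exists_le B
  have hPsi (t : ℝ) (ht : t₀ ≤ t) : S.Psi t ≤ |P| :=
    Real.iSup_le (fun a => ((hB a t ht).trans (hP a)).trans (le_abs_self P)) (abs_nonneg P)
  exact ⟨S.G.diam * |P|, by positivity,
    fun t ht => mul_le_mul_of_nonneg_left (hPsi t ht) (Nat.cast_nonneg _)⟩

theorem dist_le_length_mul_Psi (hx : (t, x) ∈ S.funnel) {i j : Fin N} (c : S.G.Walk i j) :
    dist (x.1 i) (x.1 j) ≤ c.length * S.Psi t := by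
  induction c with
  | nil => simp
  | cons h c ih =>
    have hstep : dist (x.1 _) (x.1 _) ≤ S.Psi t :=
      (dist_pi_le_iff (Psi_nonneg hx)).2 fun p => by
        rw [dist_comm, Real.dist_eq]
        exact (hx _ _ p h).le.trans (ψ_le_Psi h p t)
    calc dist (x.1 _) (x.1 _) ≤ S.Psi t + c.length * S.Psi t :=
          (dist_triangle _ _ _).trans (add_le_add hstep ih)
      _ = (SimpleGraph.Walk.cons h c).length * S.Psi t := by
          rw [SimpleGraph.Walk.length_cons]
          push_cast
          ring

theorem syncBound_nonneg (hx : (t, x) ∈ S.funnel) : 0 ≤ S.syncBound t :=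
  mul_nonneg (Nat.cast_nonneg _) (Psi_nonneg hx)

theorem dist_le_syncBound (hGraph : S.G.Connected) (hx : (t, x) ∈ S.funnel) (i j : Fin N) :
    dist (x.1 i) (x.1 j) ≤ S.syncBound t := by
  have := hGraph.nonempty
  obtain ⟨c, hc⟩ := (hGraph.preconnected i j).exists_walk_length_eq_dist
  have hlength : c.length ≤ S.G.diam :=
    hc ▸ SimpleGraph.dist_le_diam (SimpleGraph.connected_iff_ediam_ne_top.1 hGraph)
  exact (dist_le_length_mul_Psi hx c).trans
    (mul_le_mul_of_nonneg_right (Nat.cast_le.2 hlength) (Psi_nonneg hx))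

theorem norm_deviation_le (hGraph : S.G.Connected) (hx : (t, x) ∈ S.funnel) :
    ‖deviation x‖ ≤ S.syncBound t := by
  refine (pi_norm_le_iff_of_nonneg (syncBound_nonneg hx)).2 fun i => ?_
  have hN : (N : ℝ) ≠ 0 := Nat.cast_ne_zero.2 (Fin.pos i).ne'
  rw [deviation, average_fst, ← mem_closedBall_iff_norm', Finset.smul_sum]
  refine (convex_closedBall _ _).sum_mem (fun _ _ => ?_) ?_ fun j _ =>
    dist_le_syncBound hGraph hx j i
  · positivity
  · simp [hN]

theorem dist_average_le (hGraph : S.G.Connected) (hx : (t, x) ∈ S.funnel) (i : Fin N) :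
    dist (x.1 i, x.2) (average m n x) ≤ S.syncBound t := by
  refine max_le ?_ ?_
  · rw [dist_eq_norm]
    exact (norm_le_pi_norm (deviation x) i).trans (norm_deviation_le hGraph hx)
  · rw [average_snd, dist_self]
    exact syncBound_nonneg hx

end MultiAgentSystem

namespace MultiAgentSystem

variable {N m : ℕ} {n q : Fin N → ℕ} {S : MultiAgentSystem N m n q} {t₀ t₁ : ℝ}

/-! ### Closed loop solutions and the blended dynamics -/

/-- The deviations along a trajectory on `[t₁, ω)`, extended by zero to an input for all times. -/
noncomputable def deviationInput (t₁ : ℝ) (ω : EReal) (x : ℝ → NetworkState m n) :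
    ℝ → Fin N → Fin m → ℝ :=
  (timeInterval t₁ ω).indicator fun t => deviation (x t)

section

variable {ω : EReal} {x : ℝ → NetworkState m n}

theorem deviationInput_of_mem {t : ℝ} (ht : t ∈ timeInterval t₁ ω) :
    deviationInput t₁ ω x t = deviation (x t) :=
  Set.indicator_of_mem ht _

theorem norm_deviationInput_le (hGraph : S.G.Connected) {P : ℝ} (hP₀ : 0 ≤ P)
    (hP : ∀ t, t₀ ≤ t → S.syncBound t ≤ P) (ht₁ : t₀ ≤ t₁)
    (hx : IsSolution S.funnel S.closedLoop t₁ ω x) (t : ℝ) : ‖deviationInput t₁ ω x t‖ ≤ P := by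
  rw [deviationInput, norm_indicator_eq_indicator_norm]
  exact Set.indicator_apply_le'
    (fun ht => (norm_deviation_le hGraph (hx.mem_domain t ht)).trans (hP t (ht₁.trans ht.1)))
    fun _ => hP₀

theorem isLocEssBounded_deviationInput (hGraph : S.G.Connected) (hDesign : S.DesignAssumption t₀)
    (ht₁ : t₀ ≤ t₁) (hx : IsSolution S.funnel S.closedLoop t₁ ω x) :
    IsLocEssBounded t₁ (deviationInput t₁ ω x) := by
  obtain ⟨P, hP₀, hP⟩ := exists_syncBound_le hDesign
  have hmeas : AEStronglyMeasurable (deviationInput t₁ ω x) volume :=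
    (aestronglyMeasurable_indicator_iff measurableSet_timeInterval).2
      ((continuous_deviation.comp_continuousOn hx.continuousOn).aestronglyMeasurable
        measurableSet_timeInterval)
  exact fun T => memLp_top_of_bound hmeas.restrict P
    (ae_of_all _ (norm_deviationInput_le hGraph hP₀ hP ht₁ hx))

theorem isSolution_average (hDesign : S.DesignAssumption t₀)
    (hΓ : ∀ i t w, t₀ ≤ t → IsUnit (S.Γ i t w)) (ht₁ : t₀ ≤ t₁)
    (hx : IsSolution S.funnel S.closedLoop t₁ ω x) :
    IsSolution Set.univ (fun t ξ => S.blended t ξ (deviationInput t₁ ω x t)) t₁ ω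
      (fun t => average m n (x t)) :=
  hx.map _ fun t ht => by
    have ht₀ := ht₁.trans ht.1
    rw [deviationInput_of_mem ht,
      average_closedLoop hDesign (fun i w => hΓ i t w ht₀) ht₀ (hx.mem_domain t ht)]

end

theorem norm_le_norm_average_add_norm_deviation (x : NetworkState m n) :
    ‖x‖ ≤ ‖average m n x‖ + ‖deviation x‖ :=
  calc ‖x‖ = ‖spread (average m n x) (deviation x)‖ := by rw [spread_average_deviation]
    _ ≤ ‖average m n x‖ + ‖deviation x‖ := by
      refine max_le ((pi_norm_le_iff_of_nonneg (by positivity)).2 fun i => ?_) ?_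
      · exact (norm_add_le _ _).trans
          (add_le_add (norm_fst_le _) (norm_le_pi_norm (deviation x) i))
      · exact (norm_snd_le (average m n x)).trans (le_add_of_nonneg_right (norm_nonneg _))

theorem exists_norm_le_of_isSolution (hOpen : IsRegularField t₀ S.openLoop)
    (hΓ : ∀ i t w, t₀ ≤ t → IsUnit (S.Γ i t w)) (hGraph : S.G.Connected)
    (hDesign : S.DesignAssumption t₀) {b : ℝ} {x : ℝ → NetworkState m n} (ht₁ : t₀ ≤ t₁)
    (hx : IsSolution S.funnel S.closedLoop t₁ b x) {y : ℝ → BlendedState m n}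
    (hy : IsSolution Set.univ (fun t ξ => S.blended t ξ (deviationInput t₁ b x t)) t₁ ⊤ y)
    (h₁ : y t₁ = average m n (x t₁)) : ∃ R, ∀ t ∈ Set.Ico t₁ b, ‖x t‖ ≤ R := by
  obtain ⟨P, hP₀, hP⟩ := exists_syncBound_le hDesign
  have haverage : Set.EqOn (fun t => average m n (x t)) y (timeInterval t₁ b) := by
    refine (isSolution_average hDesign hΓ ht₁ hx).eqOn_of_lipschitzOnWith
      (hy.mono_right hx.lt le_top) h₁.symm fun K hK T => ?_
    obtain ⟨L, hL⟩ := exists_lipschitzOnWith_blended hOpen hK P T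
    exact ⟨L, fun t ht =>
      hL t ⟨ht₁.trans ht.1, ht.2⟩ _ (norm_deviationInput_le hGraph hP₀ hP ht₁ hx t)⟩
  have hlt : t₁ < b := EReal.coe_lt_coe_iff.1 hx.lt
  obtain ⟨C, hC⟩ := isCompact_Icc.exists_bound_of_continuousOn
    (hy.continuousOn_Icc (T := b) ⟨hlt.le, EReal.coe_lt_top b⟩)
  refine ⟨C + P, fun t ht => ?_⟩
  have ht' : t ∈ timeInterval t₁ b := timeInterval_coe (t₁ := t₁) b ▸ ht
  calc ‖x t‖ ≤ ‖average m n (x t)‖ + ‖deviation (x t)‖ :=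
        norm_le_norm_average_add_norm_deviation (x t)
    _ = ‖y t‖ + ‖deviation (x t)‖ := congrArg (‖·‖ + ‖deviation (x t)‖) (haverage ht')
    _ ≤ C + P := add_le_add (hC t ⟨ht.1, ht.2.le⟩)
        ((norm_deviation_le hGraph (hx.mem_domain t ht')).trans (hP t (ht₁.trans ht.1)))

/-! ### Dissipation of energy -/

theorem continuousOn_ψ (hDesign : S.DesignAssumption t₀) {i j : Fin N} (h : S.G.Adj i j)
    (p : Fin m) : ContinuousOn (S.ψ i j p) (Set.Ici t₀) :=
  (hDesign.ψ_contDiffOn i j p h).continuousOn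

theorem exists_abs_edgeForce_le (hDesign : S.DesignAssumption t₀) (b : ℝ) (i j : Fin N)
    (p : Fin m) : ∃ C D : ℝ, 0 < D ∧ ∀ t ∈ Set.Icc t₀ b, ∀ x, (t, x) ∈ S.funnel →
      |S.edgeForce p i j t x| ≤ D * ((x.1 j p - x.1 i p) * S.edgeForce p i j t x + C) := by
  by_cases h : S.G.Adj i j
  swap
  · exact ⟨0, 1, one_pos, fun t _ x _ => by simp [edgeForce_of_not_adj h]⟩
  obtain ⟨C, hC₀, hC⟩ := exists_half_abs_sub_le_mul (hDesign.μ_continuousOn i j p h)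
    (hDesign.μ_tendsto_right i j p h) (hDesign.μ_tendsto_left i j p h)
  obtain ⟨P, hP⟩ := hDesign.ψ_bounded i j p h
  obtain ⟨c, hc₀, hc⟩ := isCompact_Icc.exists_forall_le'
    ((continuousOn_ψ hDesign h p).mono Set.Icc_subset_Ici_self)
    fun t (ht : t ∈ Set.Icc t₀ b) => hDesign.ψ_pos i j p h t ht.1
  refine ⟨|P| * C, 2 / c, by positivity, fun t ht x hx => ?_⟩
  have hψ := hDesign.ψ_pos i j p h t ht.1
  set r := (x.1 j p - x.1 i p) / S.ψ i j p t with hr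
  have hν : x.1 j p - x.1 i p = S.ψ i j p t * r := (mul_div_cancel₀ _ hψ.ne').symm
  have hdiss := hC r (div_mem_Ioo_of_mem_funnel hx h p)
  rw [edgeForce_of_adj h, ← hr, div_mul_eq_mul_div, le_div_iff₀ hc₀]
  calc |S.μ i j p r| * c ≤ |S.μ i j p r| * S.ψ i j p t :=
        mul_le_mul_of_nonneg_left (hc t ht) (abs_nonneg _)
    _ ≤ 2 * (S.ψ i j p t * (r * S.μ i j p r) + S.ψ i j p t * C) := by nlinarith
    _ ≤ 2 * ((x.1 j p - x.1 i p) * S.μ i j p r + |P| * C) := by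
        rw [hν, mul_assoc]
        gcongr
        exact (hP t ht.1).trans (le_abs_self P)

theorem exists_uniform_abs_edgeForce_le (hDesign : S.DesignAssumption t₀) (b : ℝ) :
    ∃ C D : ℝ, 0 ≤ D ∧ ∀ i j p, ∀ t ∈ Set.Icc t₀ b, ∀ x, (t, x) ∈ S.funnel →
      |S.edgeForce p i j t x| ≤ D * ((x.1 j p - x.1 i p) * S.edgeForce p i j t x + C) ∧
        0 ≤ (x.1 j p - x.1 i p) * S.edgeForce p i j t x + C := by
  choose C D hD₀ h using fun a : Fin N × Fin N × Fin m =>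
    exists_abs_edgeForce_le hDesign b a.1 a.2.1 a.2.2
  obtain ⟨C', hC'⟩ := Finite.exists_le C
  obtain ⟨D', hD'⟩ := Finite.exists_le D
  refine ⟨C', |D'|, abs_nonneg _, fun i j p t ht x hx => ?_⟩
  have hle := h (i, j, p) t ht x hx
  have hC := hC' (i, j, p)
  have hD := (hD' (i, j, p)).trans (le_abs_self D')
  have hnonneg : 0 ≤ (x.1 j p - x.1 i p) * S.edgeForce p i j t x + C (i, j, p) :=
    nonneg_of_mul_nonneg_right ((abs_nonneg _).trans hle) (hD₀ (i, j, p))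
  exact ⟨hle.trans (by gcongr), by linarith⟩

theorem exists_norm_couplingForce_le (hDesign : S.DesignAssumption t₀) (b : ℝ) :
    ∃ A B : ℝ, 0 ≤ B ∧ ∀ t ∈ Set.Icc t₀ b, ∀ x, (t, x) ∈ S.funnel →
      ‖S.couplingForce t x‖ ≤
        A - B * ∑ a : Fin N × Fin m, x.1 a.1 a.2 * S.couplingForce t x a.1 a.2 := by
  obtain ⟨C, D, hD, h⟩ := exists_uniform_abs_edgeForce_le hDesign b
  refine ⟨D * ∑ _a : Fin N × Fin m, ∑ _j : Fin N, C, 2 * D, by positivity, fun t ht x hx => ?_⟩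
  let power (a : Fin N × Fin m) : ℝ :=
    ∑ j, ((x.1 j a.2 - x.1 a.1 a.2) * S.edgeForce a.2 a.1 j t x + C)
  have hpower (a : Fin N × Fin m) : 0 ≤ power a :=
    Finset.sum_nonneg fun j _ => (h a.1 j a.2 t ht x hx).2
  have hcomponent (i : Fin N) (p : Fin m) : |S.couplingForce t x i p| ≤ D * ∑ a, power a :=
    calc |S.couplingForce t x i p| ≤ ∑ j, |S.edgeForce p i j t x| :=
          Finset.abs_sum_le_sum_abs _ _
      _ ≤ D * power (i, p) := by
          rw [Finset.mul_sum]
          exact Finset.sum_le_sum fun j _ => (h i j p t ht x hx).1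
      _ ≤ D * ∑ a, power a := mul_le_mul_of_nonneg_left
          (Finset.single_le_sum (fun a _ => hpower a) (Finset.mem_univ (i, p))) hD
  have henergy : ∑ a : Fin N × Fin m, ∑ j, (x.1 j a.2 - x.1 a.1 a.2) * S.edgeForce a.2 a.1 j t x =
      -(2 * ∑ a : Fin N × Fin m, x.1 a.1 a.2 * S.couplingForce t x a.1 a.2) := by
    rw [Fintype.sum_prod_type_right, Fintype.sum_prod_type_right, Finset.mul_sum,
      ← Finset.sum_neg_distrib]
    exact Finset.sum_congr rfl fun p _ => neg_eq_iff_eq_neg.1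
      (two_mul_sum_mul_sum_of_antisymm (edgeForce_antisymm hDesign ht.1 hx p) fun i => x.1 i p).symm
  have hnonneg : 0 ≤ D * ∑ a, power a := mul_nonneg hD (Finset.sum_nonneg fun a _ => hpower a)
  calc ‖S.couplingForce t x‖ ≤ D * ∑ a, power a :=
        (pi_norm_le_iff_of_nonneg hnonneg).2 fun i => (pi_norm_le_iff_of_nonneg hnonneg).2 fun p =>
          hcomponent i p
    _ = _ := by
        simp only [power, Finset.sum_add_distrib, henergy]
        ring

/-- The coordinate `p` of the output of agent `i`, for `a = (i, p)`. -/
noncomputable def outputCoord (a : Fin N × Fin m) : NetworkState m n →L[ℝ] ℝ :=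
  ContinuousLinearMap.proj a.2 ∘L ContinuousLinearMap.proj a.1 ∘L ContinuousLinearMap.fst ℝ _ _

theorem abs_outputCoord_le (a : Fin N × Fin m) (x : NetworkState m n) : |outputCoord a x| ≤ ‖x‖ :=
  ((norm_le_pi_norm (x.1 a.1) a.2).trans (norm_le_pi_norm x.1 a.1)).trans (norm_fst_le x)

theorem exists_norm_closedLoop_le (hOpen : IsRegularField t₀ S.openLoop)
    (hΓ : ∀ i t w, t₀ ≤ t → IsUnit (S.Γ i t w)) (hDesign : S.DesignAssumption t₀) (b R : ℝ) :
    ∃ A B : ℝ, 0 ≤ B ∧ ∀ t ∈ Set.Icc t₀ b, ∀ x, (t, x) ∈ S.funnel → ‖x‖ ≤ R →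
      ‖S.closedLoop t x‖ ≤ A - B * ∑ a, outputCoord a x * outputCoord a (S.closedLoop t x) := by
  obtain ⟨M, hM⟩ := hOpen.bounded _ (isCompact_closedBall (0 : NetworkState m n) R)
  obtain ⟨A, B, hB, h⟩ := exists_norm_couplingForce_le hDesign b
  refine ⟨M + A + B * ∑ _a : Fin N × Fin m, R * M, B, hB, fun t ht x hx hxR => ?_⟩
  have hopen : ‖S.openLoop t x‖ ≤ M := hM t ht.1 x (mem_closedBall_zero_iff.2 hxR)
  have hpower : ∑ a, outputCoord a x * outputCoord a (S.openLoop t x) ≤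
      ∑ _a : Fin N × Fin m, R * M := by
    refine Finset.sum_le_sum fun a _ => (le_abs_self _).trans ?_
    rw [abs_mul]
    exact mul_le_mul ((abs_outputCoord_le a x).trans hxR) ((abs_outputCoord_le a _).trans hopen)
      (abs_nonneg _) ((norm_nonneg x).trans hxR)
  have hsplit : ∑ a, outputCoord a x * outputCoord a (S.closedLoop t x) =
      ∑ a, outputCoord a x * outputCoord a (S.openLoop t x) +
        ∑ a : Fin N × Fin m, x.1 a.1 a.2 * S.couplingForce t x a.1 a.2 := by
    simp only [closedLoop_eq fun i w => hΓ i t w ht.1, map_add, mul_add, Finset.sum_add_distrib]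
    rfl
  have hcoupling : ‖((S.couplingForce t x, 0) : NetworkState m n)‖ = ‖S.couplingForce t x‖ := by
    simp
  calc ‖S.closedLoop t x‖ ≤ ‖S.openLoop t x‖ + ‖S.couplingForce t x‖ := by
        rw [closedLoop_eq fun i w => hΓ i t w ht.1, ← hcoupling]
        exact norm_add_le _ _
    _ ≤ M + (A - B * ∑ a : Fin N × Fin m, x.1 a.1 a.2 * S.couplingForce t x a.1 a.2) :=
        add_le_add hopen (h t ht x hx)
    _ ≤ _ := by
        rw [hsplit]
        linarith [mul_le_mul_of_nonneg_left hpower hB]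

theorem intervalIntegrable_closedLoop (hOpen : IsRegularField t₀ S.openLoop)
    (hΓ : ∀ i t w, t₀ ≤ t → IsUnit (S.Γ i t w)) (hDesign : S.DesignAssumption t₀)
    {b R : ℝ} {x : ℝ → NetworkState m n} (ht₁ : t₀ ≤ t₁)
    (hx : IsSolution S.funnel S.closedLoop t₁ b x) (hR : ∀ t ∈ Set.Ico t₁ b, ‖x t‖ ≤ R) :
    IntervalIntegrable (fun s => S.closedLoop s (x s)) volume t₁ b := by
  obtain ⟨A, B, hB, h⟩ := exists_norm_closedLoop_le hOpen hΓ hDesign b R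
  refine hx.intervalIntegrable_of_norm_le_sub_energy (A := A) outputCoord hB fun t ht => ?_
  exact h t ⟨ht₁.trans ht.1, ht.2.le⟩ (x t)
    (hx.mem_domain t (timeInterval_coe (t₁ := t₁) b ▸ ht)) (hR t ht)

end MultiAgentSystem

namespace MultiAgentSystem

variable {N m : ℕ} {n q : Fin N → ℕ} {S : MultiAgentSystem N m n q} {t₀ t₁ b : ℝ}

/-! ### Invariance of the funnel -/

/-- The part of the funnel at times from `t₀` on, where the assumptions on the design functions
apply. -/
def funnelFrom (S : MultiAgentSystem N m n q) (t₀ : ℝ) : Set (ℝ × NetworkState m n) :=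
  S.funnel ∩ {a | t₀ ≤ a.1}

/-- At `a = (b, x)` the edge from `j` to `k` lies on the side of the boundary of the funnel where
component `p` of agent `k` is too large. -/
def IsSaturated (S : MultiAgentSystem N m n q) (a : ℝ × NetworkState m n) (p : Fin m)
    (k j : Fin N) : Prop :=
  S.G.Adj k j ∧ a.2.1 k p - a.2.1 j p = S.ψ k j p a.1

theorem continuousOn_edgeRatio (hDesign : S.DesignAssumption t₀) {k j : Fin N} (h : S.G.Adj k j)
    (p : Fin m) : ContinuousOn
      (fun a : ℝ × NetworkState m n => (a.2.1 j p - a.2.1 k p) / S.ψ k j p a.1)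
      {a | t₀ ≤ a.1} :=
  ContinuousOn.div (by fun_prop)
    ((continuousOn_ψ hDesign h p).comp continuousOn_fst fun _ ha => ha)
    fun a ha => (hDesign.ψ_pos k j p h a.1 ha).ne'

section

variable {a : ℝ × NetworkState m n} {p : Fin m} {k j : Fin N}

theorem continuousWithinAt_edgeRatio (hDesign : S.DesignAssumption t₀) (ha₀ : t₀ ≤ a.1)
    (h : S.G.Adj k j) (p : Fin m) : ContinuousWithinAt
      (fun c : ℝ × NetworkState m n => (c.2.1 j p - c.2.1 k p) / S.ψ k j p c.1)
      (S.funnelFrom t₀) a :=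
  (continuousOn_edgeRatio hDesign h p a ha₀).mono Set.inter_subset_right

theorem edgeRatio_mem_Icc (hDesign : S.DesignAssumption t₀) (ha₀ : t₀ ≤ a.1)
    (ha : a ∈ closure (S.funnelFrom t₀)) (h : S.G.Adj k j) (p : Fin m) :
    (a.2.1 j p - a.2.1 k p) / S.ψ k j p a.1 ∈ Set.Icc (-1 : ℝ) 1 := by
  rw [← closure_Ioo (by norm_num : (-1 : ℝ) ≠ 1)]
  exact (continuousWithinAt_edgeRatio hDesign ha₀ h p).mem_closure ha fun c hc =>
    div_mem_Ioo_of_mem_funnel hc.1 h p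

theorem edgeRatio_eq_neg_one_iff (hDesign : S.DesignAssumption t₀) (ha₀ : t₀ ≤ a.1)
    (h : S.G.Adj k j) :
    (a.2.1 j p - a.2.1 k p) / S.ψ k j p a.1 = -1 ↔ S.IsSaturated a p k j := by
  rw [div_eq_iff (hDesign.ψ_pos k j p h a.1 ha₀).ne', neg_one_mul, ← neg_sub, neg_inj, IsSaturated,
    and_iff_right h]

theorem mem_funnel_of_not_isSaturated (hDesign : S.DesignAssumption t₀) (ha₀ : t₀ ≤ a.1)
    (ha : a ∈ closure (S.funnelFrom t₀)) (hsat : ∀ p k j, ¬S.IsSaturated a p k j) :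
    a ∈ S.funnel := by
  intro i j p h
  have hlower {k l : Fin N} (h' : S.G.Adj k l) : -(S.ψ k l p a.1) < a.2.1 l p - a.2.1 k p := by
    have hψ := hDesign.ψ_pos k l p h' a.1 ha₀
    rw [← neg_one_mul, ← lt_div_iff₀ hψ]
    exact (edgeRatio_mem_Icc hDesign ha₀ ha h' p).1.lt_of_ne' fun heq =>
      hsat p k l ((edgeRatio_eq_neg_one_iff hDesign ha₀ h').1 heq)
  have hupper := hlower h.symm
  rw [← hDesign.ψ_symm i j p h a.1 ha₀] at hupper
  exact abs_lt.2 ⟨hlower h, by linarith⟩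

theorem exists_eventually_neg_le_edgeForce (hDesign : S.DesignAssumption t₀) (ha₀ : t₀ ≤ a.1)
    (ha : a ∈ closure (S.funnelFrom t₀)) (hsat : ¬S.IsSaturated a p k j) :
    ∃ C, ∀ᶠ c in 𝓝[S.funnelFrom t₀] a, -C ≤ S.edgeForce p k j c.1 c.2 := by
  by_cases h : S.G.Adj k j
  swap
  · exact ⟨0, Eventually.of_forall fun c => by simp [edgeForce_of_not_adj h]⟩
  simp only [edgeForce_of_adj h]
  have hlim := (continuousWithinAt_edgeRatio hDesign ha₀ h p).tendsto
  obtain ⟨hge, hle⟩ := edgeRatio_mem_Icc hDesign ha₀ ha h p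
  have hgt := hge.lt_of_ne' fun heq => hsat ((edgeRatio_eq_neg_one_iff hDesign ha₀ h).1 heq)
  rcases hle.eq_or_lt with heq | hlt
  · rw [heq] at hlim
    have hμ := (hDesign.μ_tendsto_right k j p h).comp (tendsto_nhdsWithin_iff.2 ⟨hlim,
      eventually_mem_nhdsWithin.mono fun c hc => (div_mem_Ioo_of_mem_funnel hc.1 h p).2⟩)
    exact ⟨0, by simpa using hμ.eventually_ge_atTop 0⟩
  · have hμ := ((hDesign.μ_continuousOn k j p h).continuousAt (Ioo_mem_nhds hgt hlt)).tendsto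
    obtain ⟨C, hC⟩ := (hμ.comp hlim).isBoundedUnder_ge.eventually_ge
    exact ⟨-C, by simpa using hC⟩

theorem exists_eventually_edgeForce_le (hDesign : S.DesignAssumption t₀) (ha₀ : t₀ ≤ a.1)
    (ha : a ∈ closure (S.funnelFrom t₀)) (hsat : ¬S.IsSaturated a p j k) :
    ∃ C, ∀ᶠ c in 𝓝[S.funnelFrom t₀] a, S.edgeForce p k j c.1 c.2 ≤ C := by
  obtain ⟨C, hC⟩ := exists_eventually_neg_le_edgeForce hDesign ha₀ ha hsat
  refine ⟨C, ?_⟩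
  filter_upwards [hC, self_mem_nhdsWithin] with c hle hc
  rw [edgeForce_antisymm hDesign hc.2 hc.1]
  exact neg_le.1 hle

theorem IsSaturated.tendsto_edgeForce (hDesign : S.DesignAssumption t₀) (ha₀ : t₀ ≤ a.1)
    (hsat : S.IsSaturated a p k j) :
    Tendsto (fun c : ℝ × NetworkState m n => S.edgeForce p k j c.1 c.2) (𝓝[S.funnelFrom t₀] a)
      atBot := by
  simp only [edgeForce_of_adj hsat.1]
  refine (hDesign.μ_tendsto_left k j p hsat.1).comp (tendsto_nhdsWithin_iff.2 ⟨?_,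
    eventually_mem_nhdsWithin.mono fun c hc => (div_mem_Ioo_of_mem_funnel hc.1 hsat.1 p).1⟩)
  rw [← (edgeRatio_eq_neg_one_iff hDesign ha₀ hsat.1).2 hsat]
  exact continuousWithinAt_edgeRatio hDesign ha₀ hsat.1 p

theorem IsSaturated.exists_sub_le (hDesign : S.DesignAssumption t₀) (ha₀ : t₀ ≤ a.1)
    (hsat : S.IsSaturated a p k j) :
    ∃ D, ∀ c ∈ S.funnelFrom t₀,
      c.2.1 k p - c.2.1 j p ≤ a.2.1 k p - a.2.1 j p + D * |a.1 - c.1| := by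
  obtain ⟨D, hD⟩ := hDesign.ψ_deriv_bounded k j p hsat.1
  refine ⟨D, fun c hc => ?_⟩
  have hψ : |S.ψ k j p c.1 - S.ψ k j p a.1| ≤ D * |c.1 - a.1| :=
    (convex_Ici t₀).norm_image_sub_le_of_norm_derivWithin_le
      ((hDesign.ψ_contDiffOn k j p hsat.1).differentiableOn one_ne_zero) (fun u hu => hD u hu)
      ha₀ hc.2
  have hfunnel := (abs_lt.1 (hc.1 k j p hsat.1)).1
  rw [abs_sub_comm c.1] at hψ
  linarith [(abs_le.1 hψ).2, hsat.2]

theorem exists_eventually_abs_openLoop_le (hOpen : IsRegularField t₀ S.openLoop)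
    (a : ℝ × NetworkState m n) (i : Fin N × Fin m) :
    ∃ K, ∀ᶠ c in 𝓝[S.funnelFrom t₀] a, |outputCoord i (S.openLoop c.1 c.2)| ≤ K := by
  obtain ⟨K, hK⟩ := hOpen.bounded _ (isCompact_closedBall a.2 1)
  refine ⟨K, ?_⟩
  filter_upwards [self_mem_nhdsWithin, nhdsWithin_le_nhds
    (continuousAt_snd.preimage_mem_nhds (Metric.closedBall_mem_nhds a.2 one_pos))] with c hc hball
  exact (abs_outputCoord_le i _).trans (hK c.1 hc.2 c.2 hball)

theorem outputCoord_closedLoop (hΓ : ∀ i w, IsUnit (S.Γ i b w)) (k : Fin N) (p : Fin m)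
    (x : NetworkState m n) : outputCoord (k, p) (S.closedLoop b x) =
      outputCoord (k, p) (S.openLoop b x) + ∑ j, S.edgeForce p k j b x := by
  rw [closedLoop_eq hΓ, map_add]
  rfl

theorem exists_eventually_neg_le_closedLoop (hOpen : IsRegularField t₀ S.openLoop)
    (hΓ : ∀ i t w, t₀ ≤ t → IsUnit (S.Γ i t w)) (hDesign : S.DesignAssumption t₀)
    (ha₀ : t₀ ≤ a.1) (ha : a ∈ closure (S.funnelFrom t₀)) (hsat : ∀ j, ¬S.IsSaturated a p k j) :
    ∃ C, ∀ᶠ c in 𝓝[S.funnelFrom t₀] a, -C ≤ outputCoord (k, p) (S.closedLoop c.1 c.2) := by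
  obtain ⟨K, hK⟩ := exists_eventually_abs_openLoop_le hOpen a (k, p)
  choose C hC using fun j => exists_eventually_neg_le_edgeForce hDesign ha₀ ha (hsat j)
  refine ⟨K + ∑ j, C j, ?_⟩
  filter_upwards [hK, eventually_all.2 hC, self_mem_nhdsWithin] with c hKc hCc hc
  rw [outputCoord_closedLoop fun i w => hΓ i c.1 w hc.2, neg_add, ← Finset.sum_neg_distrib]
  exact add_le_add (abs_le.1 hKc).1 (Finset.sum_le_sum fun j _ => hCc j)

theorem IsSaturated.tendsto_closedLoop (hOpen : IsRegularField t₀ S.openLoop)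
    (hΓ : ∀ i t w, t₀ ≤ t → IsUnit (S.Γ i t w)) (hDesign : S.DesignAssumption t₀)
    (ha₀ : t₀ ≤ a.1) (ha : a ∈ closure (S.funnelFrom t₀)) (hsat : S.IsSaturated a p k j)
    (htop : ∀ i, ¬S.IsSaturated a p i k) :
    Tendsto (fun c : ℝ × NetworkState m n => outputCoord (k, p) (S.closedLoop c.1 c.2))
      (𝓝[S.funnelFrom t₀] a) atBot := by
  obtain ⟨K, hK⟩ := exists_eventually_abs_openLoop_le hOpen a (k, p)
  choose C hC using fun i => exists_eventually_edgeForce_le hDesign ha₀ ha (htop i)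
  refine tendsto_atBot_mono' _ ?_ (tendsto_atBot_add_const_left _ K
    (tendsto_atBot_add_const_right _ (∑ i ∈ Finset.univ.erase j, C i)
      (hsat.tendsto_edgeForce hDesign ha₀)))
  filter_upwards [hK, eventually_all.2 hC, self_mem_nhdsWithin] with c hKc hCc hc
  rw [outputCoord_closedLoop fun i w => hΓ i c.1 w hc.2,
    ← Finset.add_sum_erase _ _ (Finset.mem_univ j)]
  gcongr with i
  · exact (abs_le.1 hKc).2
  · exact hCc i

end

section

variable {x : ℝ → NetworkState m n}

theorem tendsto_nhdsWithin_funnelFrom (ht₁ : t₀ ≤ t₁)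
    (hx : IsSolution S.funnel S.closedLoop t₁ b x)
    (hint : IntervalIntegrable (fun s => S.closedLoop s (x s)) volume t₁ b) :
    Tendsto (fun t => (t, x t)) (𝓝[<] b)
      (𝓝[S.funnelFrom t₀] (b, x t₁ + ∫ s in t₁..b, S.closedLoop s (x s))) := by
  refine tendsto_nhdsWithin_iff.2
    ⟨(tendsto_nhdsWithin_of_tendsto_nhds tendsto_id).prodMk_nhds (hx.tendsto_nhdsLT hint), ?_⟩
  filter_upwards [Ioo_mem_nhdsLT (EReal.coe_lt_coe_iff.1 hx.lt)] with t ht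
  exact ⟨hx.mem_domain t (timeInterval_coe (t₁ := t₁) b ▸ Set.Ioo_subset_Ico_self ht),
    ht₁.trans ht.1.le⟩

theorem limit_mem_funnel (hOpen : IsRegularField t₀ S.openLoop)
    (hΓ : ∀ i t w, t₀ ≤ t → IsUnit (S.Γ i t w)) (hDesign : S.DesignAssumption t₀)
    (ht₁ : t₀ ≤ t₁) (hx : IsSolution S.funnel S.closedLoop t₁ b x)
    (hint : IntervalIntegrable (fun s => S.closedLoop s (x s)) volume t₁ b) :
    (b, x t₁ + ∫ s in t₁..b, S.closedLoop s (x s)) ∈ S.funnel := by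
  have htb : t₁ < b := EReal.coe_lt_coe_iff.1 hx.lt
  have hb : t₀ ≤ b := ht₁.trans htb.le
  have hlim := tendsto_nhdsWithin_funnelFrom ht₁ hx hint
  set L := x t₁ + ∫ s in t₁..b, S.closedLoop s (x s)
  have hclosure : (b, L) ∈ closure (S.funnelFrom t₀) :=
    mem_closure_of_tendsto (tendsto_nhdsWithin_iff.1 hlim).1 (tendsto_nhdsWithin_iff.1 hlim).2
  refine mem_funnel_of_not_isSaturated hDesign hb hclosure fun p => ?_
  refine not_saturated (y := fun k t => outputCoord (k, p) (x t))
    (g := fun k t => outputCoord (k, p) (S.closedLoop t (x t)))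
    (l := fun k => outputCoord (k, p) L) htb (fun k => ?_) (fun k t ht => ?_) (fun k j hsat => ?_)
    (fun k hk => ?_) (fun k j hsat => ?_) (fun k j hsat htop => ?_)
  · exact ⟨(outputCoord (k, p)).integrable_comp hint.1, (outputCoord (k, p)).integrable_comp hint.2⟩
  · have hsub := hint.mono_set
      (Set.uIcc_subset_uIcc_right (Set.Icc_subset_uIcc (Set.Ico_subset_Icc_self ht)))
    rw [(outputCoord (k, p)).intervalIntegral_comp_comm hsub, ← map_sub,
      hx.eq_sub_integral hint ht]
  · exact sub_pos.1 (hsat.2 ▸ hDesign.ψ_pos k j p hsat.1 b hb)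
  · obtain ⟨C, hC⟩ := exists_eventually_neg_le_closedLoop hOpen hΓ hDesign hb hclosure hk
    exact ⟨C, hlim.eventually hC⟩
  · obtain ⟨D, hD⟩ := hsat.exists_sub_le hDesign hb
    refine ⟨D, ?_⟩
    filter_upwards [(tendsto_nhdsWithin_iff.1 hlim).2, self_mem_nhdsWithin] with t ht hlt
    exact (hD _ ht).trans_eq (by rw [abs_of_pos (sub_pos.2 hlt)]; rfl)
  · have hbot := (hsat.tendsto_closedLoop hOpen hΓ hDesign hb hclosure htop).comp hlim
    exact hbot

end

/-! ### Global existence -/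

theorem continuousOn_couplingForce (hDesign : S.DesignAssumption t₀) :
    ContinuousOn (fun a : ℝ × NetworkState m n => S.couplingForce a.1 a.2) (S.funnelFrom t₀) := by
  refine continuousOn_pi.2 fun i => continuousOn_pi.2 fun p =>
    continuousOn_finsetSum _ fun j _ => ?_
  by_cases h : S.G.Adj i j
  · simp only [edgeForce_of_adj h]
    exact (hDesign.μ_continuousOn i j p h).comp
      ((continuousOn_edgeRatio hDesign h p).mono Set.inter_subset_right)
      fun a ha => div_mem_Ioo_of_mem_funnel ha.1 h p
  · simp only [edgeForce_of_not_adj h]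
    exact continuousOn_const

theorem funnel_mem_nhdsWithin (hDesign : S.DesignAssumption t₀) {a : ℝ × NetworkState m n}
    (ha₀ : t₀ ≤ a.1) (ha : a ∈ S.funnel) : S.funnel ∈ 𝓝[{c | t₀ ≤ c.1}] a := by
  refine eventually_all.2 fun i => eventually_all.2 fun j => eventually_all.2 fun p =>
    eventually_imp_distrib_left.2 fun h => ?_
  have herror : ContinuousWithinAt (fun c : ℝ × NetworkState m n => |c.2.1 j p - c.2.1 i p|)
      {c | t₀ ≤ c.1} a := by fun_prop
  have hψ : ContinuousWithinAt (fun c : ℝ × NetworkState m n => S.ψ i j p c.1)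
      {c | t₀ ≤ c.1} a :=
    (continuousOn_ψ hDesign h p).comp continuousOn_fst (fun _ hc => hc) a ha₀
  exact herror.eventually_lt hψ (ha i j p h)

theorem exists_cylinder_subset_funnelFrom (hDesign : S.DesignAssumption t₀) (hb : t₀ ≤ b)
    {x₀ : NetworkState m n} (hx₀ : (b, x₀) ∈ S.funnel) :
    ∃ r, 0 < r ∧ Set.Icc b (b + r) ×ˢ Metric.closedBall x₀ r ⊆ S.funnelFrom t₀ := by
  obtain ⟨δ, hδ, hsub⟩ := Metric.mem_nhdsWithin_iff.1 (funnel_mem_nhdsWithin hDesign hb hx₀)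
  refine ⟨δ / 2, half_pos hδ, fun a ha => ⟨hsub ⟨?_, hb.trans ha.1.1⟩, hb.trans ha.1.1⟩⟩
  have htime : dist a.1 b ≤ δ / 2 := by
    rw [Real.dist_eq, abs_of_nonneg (sub_nonneg.2 ha.1.1)]
    linarith [ha.1.2]
  exact (max_le htime ha.2).trans_lt (half_lt_self hδ)

theorem exists_isSolution (hOpen : IsRegularField t₀ S.openLoop)
    (hΓ : ∀ i t w, t₀ ≤ t → IsUnit (S.Γ i t w)) (hDesign : S.DesignAssumption t₀) (hb : t₀ ≤ b)
    {x₀ : NetworkState m n} (hx₀ : (b, x₀) ∈ S.funnel) :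
    ∃ c : ℝ, ∃ x, x b = x₀ ∧ IsSolution S.funnel S.closedLoop b c x := by
  obtain ⟨r, hr, hsub⟩ := exists_cylinder_subset_funnelFrom hDesign hb hx₀
  have hsplit {t : ℝ} (ht : t ∈ Set.Icc b (b + r)) (x : NetworkState m n) :
      S.closedLoop t x = S.openLoop t x + (S.couplingForce t x, 0) :=
    closedLoop_eq (fun i w => hΓ i t w (hb.trans ht.1)) x
  have hforce : ContinuousOn (fun a => ((S.couplingForce a.1 a.2, 0) : NetworkState m n))
      (Set.Icc b (b + r) ×ˢ Metric.closedBall x₀ r) :=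
    ((continuousOn_couplingForce hDesign).mono hsub).prodMk continuousOn_const
  obtain ⟨C, hC⟩ := (isCompact_Icc.prod (isCompact_closedBall x₀ r)).exists_bound_of_continuousOn
    hforce
  obtain ⟨K, hK⟩ := hOpen.bounded _ (isCompact_closedBall x₀ r)
  have hmeas : ∀ x ∈ Metric.closedBall x₀ r,
      AEStronglyMeasurable (S.closedLoop · x) (volume.restrict (Set.Icc b (b + r))) := by
    intro x hx
    have hsum := ((hOpen.measurable x).mono_measure (Measure.restrict_mono
      (fun t (ht : t ∈ Set.Icc b (b + r)) => hb.trans ht.1) le_rfl)).add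
      ((hforce.comp (f := fun t => (t, x)) (by fun_prop)
        fun t ht => ⟨ht, hx⟩).aestronglyMeasurable measurableSet_Icc)
    exact hsum.congr ((ae_restrict_iff' measurableSet_Icc).2
      (ae_of_all _ fun t ht => (hsplit ht x).symm))
  have hcont : ∀ t ∈ Set.Icc b (b + r), ContinuousOn (S.closedLoop t) (Metric.closedBall x₀ r) :=
    fun t ht => ((hOpen.continuous (hb.trans ht.1)).continuousOn.add
      (hforce.comp (f := fun x => (t, x)) (by fun_prop) fun x hx => ⟨ht, hx⟩)).congr
      fun x _ => hsplit ht x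
  have hbound : ∀ t ∈ Set.Icc b (b + r), ∀ x ∈ Metric.closedBall x₀ r,
      ‖S.closedLoop t x‖ ≤ (K + C).toNNReal := by
    intro t ht x hx
    rw [hsplit ht]
    exact ((norm_add_le _ _).trans (add_le_add (hK t (hb.trans ht.1) x hx)
      (hC (t, x) ⟨ht, hx⟩))).trans (Real.le_coe_toNNReal _)
  obtain ⟨c, x, hxb, hx⟩ :=
    exists_isSolution_of_continuousOn (lt_add_of_pos_right b hr) hr hmeas hcont hbound
  exact ⟨c, x, hxb, hx.lt, fun t ht => (hsub (hx.mem_domain t ht)).1, hx.integrable,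
    hx.eq_integral⟩

theorem eq_top_of_isMaximalSolution (hOpen : IsRegularField t₀ S.openLoop)
    (hΓ : ∀ i t w, t₀ ≤ t → IsUnit (S.Γ i t w)) (hGraph : S.G.Connected)
    (hDesign : S.DesignAssumption t₀)
    (hglobal : ∀ t₁, t₀ ≤ t₁ → ∀ (ξ : BlendedState m n) (e : ℝ → Fin N → Fin m → ℝ),
      IsLocEssBounded t₁ e → ∃ x : ℝ → BlendedState m n, x t₁ = ξ ∧
        IsSolution Set.univ (fun t ξ => S.blended t ξ (e t)) t₁ ⊤ x)
    (ht₁ : t₀ ≤ t₁) {ω : EReal} {x : ℝ → NetworkState m n}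
    (hx : IsMaximalSolution S.funnel S.closedLoop t₁ ω x) : ω = ⊤ := by
  induction ω with
  | bot => exact absurd hx.isSolution.lt not_lt_bot
  | top => rfl
  | coe b =>
    have hsol := hx.isSolution
    have htb : t₁ < b := EReal.coe_lt_coe_iff.1 hsol.lt
    obtain ⟨y, hy₁, hy⟩ := hglobal t₁ ht₁ (average m n (x t₁)) _
      (isLocEssBounded_deviationInput hGraph hDesign ht₁ hsol)
    obtain ⟨R, hR⟩ := exists_norm_le_of_isSolution hOpen hΓ hGraph hDesign ht₁ hsol hy hy₁
    have hint := intervalIntegrable_closedLoop hOpen hΓ hDesign ht₁ hsol hR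
    obtain ⟨c, ξ, hξb, hξ⟩ := exists_isSolution hOpen hΓ hDesign (ht₁.trans htb.le)
      (limit_mem_funnel hOpen hΓ hDesign ht₁ hsol hint)
    obtain ⟨z, hz, heq⟩ := hsol.exists_concat hint hξ hξb
    exact absurd (hx.maximal c z hz heq) hξ.lt.not_ge

end MultiAgentSystem

end FunnelCoupling

open FunnelCoupling MultiAgentSystem in
theorem theorem3_general {N m : ℕ} {n q : Fin N → ℕ} (S : MultiAgentSystem N m n q) (t₀ : ℝ)
    (hOpen : IsRegularField t₀ S.openLoop)
    (hΓ : ∀ i t w, t₀ ≤ t → IsUnit (S.Γ i t w))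
    (hGraph : S.G.Connected)
    (hDesign : S.DesignAssumption t₀)
    (A : Set (BlendedState m n)) (_hA : A.Nonempty)
    (β : ℝ → ℝ → ℝ) (γhat : ℝ → ℝ)
    (hISS : IsISS t₀ S.blended β γhat A)
    (M : ℝ) (hM : 0 ≤ M)
    (w : ℝ → ℝ) (hw_pos : ∀ t, 0 ≤ t → 0 < w t) (hw_anti : AntitoneOn w (Set.Ici 0)) :
    ∃ γ : ℝ → ℝ, IsClassKInfty γ ∧
      ∀ (t₁ : ℝ), t₀ ≤ t₁ → ∀ (ω : EReal) (x : ℝ → NetworkState m n),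
        IsMaximalSolution S.funnel S.closedLoop t₁ ω x →
        Metric.infDist
          (((1 / (N : ℝ)) • ∑ i, (x t₁).1 i, (x t₁).2) : BlendedState m n) A ≤ M →
        ω = ⊤ ∧
        ∀ t, t₁ ≤ t → ∀ i : Fin N,
          Metric.infDist (((x t).1 i, (x t).2) : BlendedState m n) A ≤
            β (Metric.infDist
                (((1 / (N : ℝ)) • ∑ j, (x t₁).1 j, (x t₁).2) : BlendedState m n) A) (t - t₁)
              + γ (⨆ s : Set.Ico t₁ t, S.syncBound s * w (t - s))
              + S.syncBound t := by
  obtain ⟨P, hP₀, hP⟩ := exists_syncBound_le hDesign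
  obtain ⟨γ, hγ, hgain⟩ := hISS.exists_fadingMemory_gain hM hP₀ hw_pos hw_anti
  refine ⟨γ, hγ, fun t₁ ht₁ ω x hx hM₁ => ?_⟩
  obtain rfl : ω = ⊤ := eq_top_of_isMaximalSolution hOpen hΓ hGraph hDesign
    hISS.exists_global ht₁ hx
  refine ⟨rfl, fun t ht i => ?_⟩
  simp only [← average_apply] at hM₁ ⊢
  have hsol := hx.isSolution
  have hfunnel (s : ℝ) (hs : t₁ ≤ s) : (s, x s) ∈ S.funnel :=
    hsol.mem_domain s ⟨hs, EReal.coe_lt_top s⟩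
  have hinput (s : ℝ) (hs : t₁ ≤ s) :
      ‖deviationInput t₁ ⊤ x s‖ ≤ S.syncBound s ∧ S.syncBound s ≤ P := by
    rw [deviationInput_of_mem ⟨hs, EReal.coe_lt_top s⟩]
    exact ⟨norm_deviation_le hGraph (hfunnel s hs), hP s (ht₁.trans hs)⟩
  have haverage := hgain t₁ ht₁ _ _ S.syncBound
    (isLocEssBounded_deviationInput hGraph hDesign ht₁ hsol)
    (isSolution_average hDesign hΓ ht₁ hsol) hinput hM₁ t ht
  exact Metric.infDist_le_infDist_add_dist.trans
    (add_le_add haverage (dist_average_le hGraph (hfunnel t ht) i))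

open FunnelCoupling in
theorem theorem3 {N m : ℕ} {n q : Fin N → ℕ} (S : MultiAgentSystem N m n q) (t₀ : ℝ)
    (hOpen : S.OpenLoopAssumption t₀)
    (hGain : S.GainAssumption t₀)
    (hGraph : S.G.Connected)
    (hDesign : S.DesignAssumption t₀)
    (hEscape : S.NoFiniteEscape t₀)
    (A : Set (BlendedState m n)) (hA : IsClosed A) (hA' : A.Nonempty)
    (β : ℝ → ℝ → ℝ) (γhat : ℝ → ℝ)
    (hISS : IsISS t₀ S.blended β γhat A)
    (M : ℝ) (hM : 0 < M)
    (w : ℝ → ℝ) (hw_mem : ∀ t, 0 ≤ t → w t ∈ Set.Ioc (0 : ℝ) 1)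
    (hw_anti : AntitoneOn w (Set.Ici 0))
    (hw_lim : Filter.Tendsto w Filter.atTop (nhds 0)) :
    ∃ γ : ℝ → ℝ, IsClassKInfty γ ∧
      ∀ (t₁ : ℝ), t₀ ≤ t₁ → ∀ (ω : EReal) (x : ℝ → NetworkState m n),
        IsMaximalSolution S.funnel S.closedLoop t₁ ω x →
        Metric.infDist
          (((1 / (N : ℝ)) • ∑ i, (x t₁).1 i, (x t₁).2) : BlendedState m n) A ≤ M →
        ω = ⊤ ∧
        ∀ t, t₁ ≤ t → ∀ i : Fin N,
          Metric.infDist (((x t).1 i, (x t).2) : BlendedState m n) A ≤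
            β (Metric.infDist
                (((1 / (N : ℝ)) • ∑ j, (x t₁).1 j, (x t₁).2) : BlendedState m n) A) (t - t₁)
              + γ (⨆ s : Set.Ico t₁ t, S.syncBound s * w (t - s))
              + S.syncBound t :=
  theorem3_general S t₀ hOpen.isRegularField_openLoop hGain.invertible hGraph hDesign A hA' β γhat
    hISS M hM.le w (fun t ht => (hw_mem t ht).1) hw_anti
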